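/- **Setting.** A length-$T$ insertion-only graph stream $S=(S_1,\dots,S_T)$ delivers at each time step a finite (possibly empty) set of new nodes and of new undirected edges between distinct nodes; the endpoints of an edge arrive no later than the edge. Write $G_t$ for the graph formed by all nodes and edges that arrive at or before time $t$. Two streams are node-neighbors if one is obtained from the other by removing one node and all its adjacent edges. A continual-release algorithm outputs at each time $t$ a value $a_t$ that depends on its random coins and on $S_1,\dots,S_t$ only. It is $(\varepsilon,\delta)$-node-DP if for all node-neighboring streams $S,S'$ of length $T$ (no degree bound is assumed) and every measurable set $A$ of output sequences, $\Pr[(a_t(S))_{t\le T}\in A]\le e^{\varepsilon}\Pr[(a_t(S'))_{t\le T}\in A]+\delta$. It has *error at most $\alpha$ for a graph statistic $f$ on $D$-bounded prefixes* if, for every stream $S$ of length $T$, with probability at least $0.99$ over its coins, $\|a_t-f(G_t)\|_\infty\le\alpha$ holds simultaneously for all $t\in[T]$ for which $G_t$ has maximum degree at most $D$. **Theorem (Accuracy of node-private algorithms).** Let $\varepsilon\in(0,1]$, $\delta\in(0,1]$, $D\in\mathbb N$ and $T\in\mathbb N$ with $T\ge 2$. For each of the following statistics $f$ there is an $(\varepsilon,\delta)$-node-DP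 continual-release algorithm on graph streams of length $T$ that has error at most $\alpha$ for $f$ on $D$-bounded prefixes: 1. number of edges: $\alpha=O\!\left(\left(D+\tfrac1\varepsilon\log\tfrac T\delta\right)\tfrac{\log^{5/2}T}{\varepsilon}\right)$; 2. number of triangles: $\alpha=O\!\left(\left(D^2+\tfrac1{\varepsilon^2}\log^2\tfrac T\delta\right)\tfrac{\log^{5/2}T}{\varepsilon}\right)$; 3. number of connected components: $\alpha=O\!\left(\left(D+\tfrac1\varepsilon\log\tfrac T\delta\right)\tfrac{\log^{5/2}T}{\varepsilon}\right)$; 4. number of $k$-stars, for every fixed $k\ge1$ (a $k$-star is a set of $k$ nodes together with a center, a common neighbor of all of them): $\alpha=O\!\left(\left(D^k+\tfrac1{\varepsilon^k}\log^k\tfrac T\delta\right)\tfrac{\log^{5/2}T}{\varepsilon}\right)$; 5. degree histogram $(a_0,\dots,a_D)\in\mathbb R^{D+1}$, where $a_i$ is the number of nodes of degree $i$: $\alpha=O\!\left(\left(D^2+\tfrac1{\varepsilon^2}\log^2\tfrac T\delta\right)\tfrac{\log^{5/2}T}{\varepsilon}\cdot\log\!\left(2+D+\tfrac1\varepsilon\log\tfrac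 T\delta\right)\right)$. The constants hidden by $O(\cdot)$ are absolute, except that in item 4 the constant may depend on $k$. -/

import Mathlib

open MeasureTheory

universe u

/-- An insertion-only graph stream with time horizon `T` and node names in `V`.  At every time step
a finite (possibly empty) set of new nodes and a finite set of new edges arrive; nothing arrives
when both sets are empty.  Edges are unordered pairs of distinct nodes, the endpoints of an edge
arrive no later than the edge, and every node and every edge arrives at most once. -/
structure GraphStream (V : Type u) (T : ℕ) where
  /-- the nodes that arrive at a time step -/
  nodes : Fin T → Finset V
  /-- the edges that arrive at a time step -/
  edges : Fin T → Finset (Sym2 V)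
  edge_not_loop : ∀ t, ∀ e ∈ edges t, ¬ e.IsDiag
  endpoint_arrived : ∀ t, ∀ e ∈ edges t, ∀ v ∈ e, ∃ s ≤ t, v ∈ nodes s
  node_once : ∀ s t v, v ∈ nodes s → v ∈ nodes t → s = t
  edge_once : ∀ s t e, e ∈ edges s → e ∈ edges t → s = t

/-- A simple graph whose vertex set is a subset of `V`. -/
abbrev GraphOn (V : Type u) : Type u := (⊤ : SimpleGraph V).Subgraph

namespace GraphStream

variable {V : Type u} {T : ℕ}

/-- The flattened graph of the stream through time `t`: all nodes and edges that have arrived at or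
before time `t`. -/
def flatten (S : GraphStream V T) (t : Fin T) : GraphOn V where
  verts := {v | ∃ s ≤ t, v ∈ S.nodes s}
  Adj u v := ∃ s ≤ t, s(u, v) ∈ S.edges s
  adj_sub := by
    rintro u v ⟨s, -, h⟩
    have h1 := S.edge_not_loop s _ h
    rw [SimpleGraph.top_adj]
    intro huv
    exact h1 (by simpa using huv)
  edge_vert := by
    rintro u v ⟨s, hs, h⟩
    obtain ⟨r, hr, hu⟩ := S.endpoint_arrived s _ h u (by simp)
    exact ⟨r, hr.trans hs, hu⟩
  symm := ⟨by
    rintro u v ⟨s, hs, h⟩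
    exact ⟨s, hs, by rwa [Sym2.eq_swap]⟩⟩

/-- `S'` is obtained from `S` by removing one node and all edges adjacent to it. -/
def RemovesNode (S S' : GraphStream V T) : Prop :=
  ∃ v : V, (∃ t, v ∈ S.nodes t) ∧
    (∀ t w, w ∈ S'.nodes t ↔ w ∈ S.nodes t ∧ w ≠ v) ∧
    (∀ t e, e ∈ S'.edges t ↔ e ∈ S.edges t ∧ v ∉ e)

/-- Node-neighboring graph streams. -/
def NodeNeighbor (S S' : GraphStream V T) : Prop :=
  RemovesNode S S' ∨ RemovesNode S' S

end GraphStream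

noncomputable section

namespace GraphOn

variable {V : Type u}

/-- The degree of a node. -/
def deg (G : GraphOn V) (v : V) : ℕ := (G.neighborSet v).ncard

/-- The graph has maximum degree at most `D`. -/
def MaxDegreeLE (G : GraphOn V) (D : ℕ) : Prop := ∀ v ∈ G.verts, deg G v ≤ D

/-- The number of edges. -/
def numEdges (G : GraphOn V) : ℝ := G.edgeSet.ncard

/-- The number of triangles, i.e. of three-element sets of pairwise adjacent nodes. -/
def numTriangles (G : GraphOn V) : ℝ :=
  {s : Finset V | s.card = 3 ∧ ∀ u ∈ s, ∀ v ∈ s, u ≠ v → G.Adj u v}.ncard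

/-- The number of connected components. -/
def numComponents (G : GraphOn V) : ℝ := Nat.card G.coe.ConnectedComponent

/-- The number of `k`-stars: a `k`-star is a set of `k` nodes together with a center, a common
neighbor of all of them. -/
def numStars (k : ℕ) (G : GraphOn V) : ℝ :=
  {p : V × Finset V | p.1 ∈ G.verts ∧ p.2.card = k ∧ ∀ u ∈ p.2, G.Adj p.1 u}.ncard

/-- The degree histogram `(a_0, …, a_D)`, where `a_i` is the number of nodes of degree `i`. -/
def degreeHist (D : ℕ) (G : GraphOn V) : Fin (D + 1) → ℝ :=
  fun i => ({v | v ∈ G.verts ∧ deg G v = (i : ℕ)}.ncard : ℝ)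

end GraphOn

/-- `(ε, δ)`-indistinguishability of two distributions on the same outcome space. -/
def Indistinguishable {Y : Type*} [MeasurableSpace Y] (ε δ : ℝ) (μ ν : Measure Y) : Prop :=
  ∀ A : Set Y, MeasurableSet A →
    μ.real A ≤ Real.exp ε * ν.real A + δ ∧ ν.real A ≤ Real.exp ε * μ.real A + δ

/-- A randomized continual-release algorithm on graph streams of length `T`: it draws random coins,
and at every time step it outputs an element of `Y` that is determined by the coins and by the part
of the stream that has arrived so far. -/
structure ContinualAlg (V : Type u) (T : ℕ) (Y : Type) [MeasurableSpace Y] where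
  /-- the coins -/
  Coins : Type
  [coinsMeasurable : MeasurableSpace Coins]
  /-- the distribution of the coins -/
  coinLaw : Measure Coins
  [coinLaw_prob : IsProbabilityMeasure coinLaw]
  /-- the output sequence on a stream -/
  output : GraphStream V T → Coins → Fin T → Y
  measurable_output : ∀ S, Measurable (output S)
  /-- the output at time `t` depends on the first `t` terms of the stream only -/
  online : ∀ (S S' : GraphStream V T) (t : Fin T),
    (∀ s ≤ t, S.nodes s = S'.nodes s ∧ S.edges s = S'.edges s) →
      ∀ ω, output S ω t = output S' ω t

namespace ContinualAlg

variable {V : Type u} {T : ℕ} {Y : Type}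

attribute [instance] ContinualAlg.coinsMeasurable ContinualAlg.coinLaw_prob

/-- The distribution of the whole output sequence on the stream `S`. -/
def outputLaw [MeasurableSpace Y] (M : ContinualAlg V T Y) (S : GraphStream V T) :
    Measure (Fin T → Y) :=
  M.coinLaw.map (M.output S)

/-- `(ε, δ)`-node-DP under (non-adaptive) continual observation, on all graph streams. -/
def IsNodeDP [MeasurableSpace Y] (M : ContinualAlg V T Y) (ε δ : ℝ) : Prop :=
  ∀ S S' : GraphStream V T, S.NodeNeighbor S' →
    Indistinguishable ε δ (M.outputLaw S) (M.outputLaw S')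

/-- On every graph stream, with probability at least `0.99`, the error of the algorithm with respect
to the graph statistic `f` is at most `α` simultaneously at all time steps `t` where the stream
through time `t` has maximum degree at most `D`.  (The norm is the absolute value for `Y = ℝ` and
the `ℓ_∞` norm for `Y = Fin d → ℝ`.) -/
def IsAccurate [MeasurableSpace Y] [NormedAddCommGroup Y] (M : ContinualAlg V T Y)
    (f : GraphOn V → Y) (D : ℕ) (α : ℝ) : Prop :=
  ∀ S : GraphStream V T,
    (0.99 : ℝ) ≤ M.coinLaw.real {ω | ∀ t : Fin T, (S.flatten t).MaxDegreeLE D →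
      ‖M.output S ω t - f (S.flatten t)‖ ≤ α}

end ContinualAlg

end

/-- The total variation of a real sequence over its first `N` steps. -/
def seqVariation (N : ℕ) (g : ℕ → ℝ) : ℝ := ∑ s ∈ Finset.range N, |g (s + 1) - g s|

section SeqVariation

variable {N : ℕ} {f g h : ℕ → ℝ}

lemma seqVariation_congr (hfg : ∀ n ≤ N, f n = g n) : seqVariation N f = seqVariation N g := by
  refine Finset.sum_congr rfl fun s hs => ?_
  have hs := Finset.mem_range.mp hs
  rw [hfg s hs.le, hfg (s + 1) hs]

lemma seqVariation_add_le (N : ℕ) (f g : ℕ → ℝ) :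
    seqVariation N (fun n => f n + g n) ≤ seqVariation N f + seqVariation N g := by
  unfold seqVariation
  rw [← Finset.sum_add_distrib]
  refine Finset.sum_le_sum fun s _ => ?_
  rw [add_sub_add_comm]
  exact abs_add_le _ _

lemma seqVariation_sub_comm (N : ℕ) (f g : ℕ → ℝ) :
    seqVariation N (fun n => f n - g n) = seqVariation N (fun n => g n - f n) := by
  refine Finset.sum_congr rfl fun s _ => ?_
  rw [← abs_neg]
  congr 1
  ring

lemma seqVariation_sub_le (N : ℕ) (f g : ℕ → ℝ) :
    seqVariation N (fun n => f n - g n) ≤ seqVariation N f + seqVariation N g := by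
  unfold seqVariation
  rw [← Finset.sum_add_distrib]
  refine Finset.sum_le_sum fun s _ => ?_
  rw [sub_sub_sub_comm]
  exact abs_sub _ _

lemma seqVariation_sub_le_add (N : ℕ) (f g h : ℕ → ℝ) :
    seqVariation N (fun n => f n - h n) ≤
      seqVariation N (fun n => f n - g n) + seqVariation N (fun n => g n - h n) := by
  refine le_trans (le_of_eq (seqVariation_congr fun n _ => ?_)) (seqVariation_add_le N _ _)
  ring

lemma seqVariation_of_monotone (hg : ∀ n < N, g n ≤ g (n + 1)) :
    seqVariation N g = g N - g 0 := by
  rw [← Finset.sum_range_sub]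
  exact Finset.sum_congr rfl fun s hs =>
    abs_of_nonneg (sub_nonneg.mpr (hg s (Finset.mem_range.mp hs)))

/-- The sizes of two increasing families of finite sets that agree off `Y`. -/
lemma seqVariation_ncard_sub_le {α : Type*} {X X' : ℕ → Set α} (hX : Monotone X)
    (hX' : Monotone X') (hfin : ∀ n, (X n).Finite) (hfin' : ∀ n, (X' n).Finite) {Y : Set α}
    (hY : Y.Finite) (h : ∀ n ≤ N, ∀ y ∉ Y, y ∈ X n ↔ y ∈ X' n) :
    seqVariation N (fun n => ((X n).ncard : ℝ) - (X' n).ncard) ≤ 2 * Y.ncard := by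
  have key : ∀ Z : ℕ → Set α, Monotone Z → (∀ n, (Z n).Finite) →
      seqVariation N (fun n => ((Z n ∩ Y).ncard : ℝ)) ≤ Y.ncard := by
    intro Z hZ hZf
    rw [seqVariation_of_monotone]
    · have h1 : ((Z N ∩ Y).ncard : ℝ) ≤ Y.ncard := by
        exact_mod_cast Set.ncard_le_ncard Set.inter_subset_right hY
      have h2 : (0 : ℝ) ≤ ((Z 0 ∩ Y).ncard : ℝ) := by positivity
      linarith
    · intro n _
      exact_mod_cast Set.ncard_le_ncard (Set.inter_subset_inter_left _ (hZ n.le_succ))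
        (hY.inter_of_right _)
  have hcongr : seqVariation N (fun n => ((X n).ncard : ℝ) - (X' n).ncard) =
      seqVariation N (fun n => ((X n ∩ Y).ncard : ℝ) - (X' n ∩ Y).ncard) := by
    refine seqVariation_congr fun n hn => ?_
    have hd : X n \ Y = X' n \ Y := by
      ext y
      simp only [Set.mem_sdiff]
      exact and_congr_left fun hy => h n hn y hy
    rw [← Set.ncard_inter_add_ncard_sdiff_eq_ncard (X n) Y (hfin n),
      ← Set.ncard_inter_add_ncard_sdiff_eq_ncard (X' n) Y (hfin' n), hd]
    push_cast
    ring
  rw [hcongr]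
  refine (seqVariation_sub_le N _ _).trans ?_
  linarith [key X hX hfin, key X' hX' hfin']

end SeqVariation

section DyadicShift

/-- The increment of `g` over the dyadic interval of level `j` that ends at `m * 2 ^ j`, which is
read as `0` when `m` is even. -/
def dyadicShift (g : ℕ → ℝ) (j m : ℕ) : ℝ := g (m * 2 ^ j) - g (m / 2 * 2 ^ (j + 1))

lemma sum_dyadicShift {g : ℕ → ℝ} (hg : g 0 = 0) {L n : ℕ} (hn : n < 2 ^ L) :
    ∑ j ∈ Finset.range L, dyadicShift g j (n / 2 ^ j) = g n := by
  have h : ∀ j, dyadicShift g j (n / 2 ^ j) =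
      g (n / 2 ^ j * 2 ^ j) - g (n / 2 ^ (j + 1) * 2 ^ (j + 1)) := by
    intro j
    rw [dyadicShift, Nat.div_div_eq_div_mul, ← pow_succ]
  simp_rw [h]
  rw [Finset.sum_range_sub' (fun j => g (n / 2 ^ j * 2 ^ j))]
  simp [Nat.div_eq_of_lt hn, hg]

lemma abs_sub_le_sum_Ico (g : ℕ → ℝ) {a b : ℕ} (hab : a ≤ b) :
    |g b - g a| ≤ ∑ s ∈ Finset.Ico a b, |g (s + 1) - g s| := by
  rw [← Finset.sum_Ico_sub _ hab]
  exact Finset.abs_sum_le_sum_abs _ _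

lemma sum_abs_dyadicShift_le (g : ℕ → ℝ) {N : ℕ} (hg : ∀ n, N ≤ n → g n = g N) (j M : ℕ) :
    ∑ m ∈ Finset.range M, |dyadicShift g j m| ≤ seqVariation N g := by
  have hle : ∀ m, m / 2 * 2 ^ (j + 1) ≤ m * 2 ^ j := by
    intro m
    rw [pow_succ', ← mul_assoc]
    exact Nat.mul_le_mul_right _ (Nat.div_mul_le_self m 2)
  set I : ℕ → Finset ℕ := fun m => Finset.Ico (m / 2 * 2 ^ (j + 1)) (m * 2 ^ j) with hI
  have hmem : ∀ m s, s ∈ I m → s / 2 ^ j + 1 = m := by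
    intro m s hs
    obtain ⟨h1, h2⟩ := Finset.mem_Ico.mp hs
    have h3 : s / 2 ^ j < m := (Nat.div_lt_iff_lt_mul (by positivity)).mpr h2
    have h4 : m / 2 * 2 ≤ s / 2 ^ j := by
      rw [Nat.le_div_iff_mul_le (by positivity)]
      calc m / 2 * 2 * 2 ^ j = m / 2 * 2 ^ (j + 1) := by ring
        _ ≤ s := h1
    omega
  have hdisj : Set.PairwiseDisjoint (Finset.range M : Set ℕ) I := by
    intro a _ b _ hab
    refine Finset.disjoint_left.mpr fun s ha hb => hab ?_
    rw [← hmem a s ha, ← hmem b s hb]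
  calc ∑ m ∈ Finset.range M, |dyadicShift g j m|
      ≤ ∑ m ∈ Finset.range M, ∑ s ∈ I m, |g (s + 1) - g s| :=
        Finset.sum_le_sum fun m _ => abs_sub_le_sum_Ico g (hle m)
    _ = ∑ s ∈ (Finset.range M).biUnion I, |g (s + 1) - g s| :=
        (Finset.sum_biUnion hdisj).symm
    _ ≤ ∑ s ∈ (Finset.range M).biUnion I ∪ Finset.range N, |g (s + 1) - g s| :=
        Finset.sum_le_sum_of_subset_of_nonneg Finset.subset_union_left
          fun _ _ _ => abs_nonneg _
    _ = seqVariation N g := by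
        refine (Finset.sum_subset Finset.subset_union_right fun s _ hs => ?_).symm
        have hs : N ≤ s := by simpa using hs
        rw [hg s hs, hg (s + 1) (hs.trans s.le_succ), sub_self, abs_zero]

end DyadicShift

noncomputable section

section Laplace

open Real

lemma integral_exp_neg_mul_abs {c : ℝ} (hc : 0 < c) : ∫ x : ℝ, exp (-(c * |x|)) = 2 / c := by
  rw [integral_comp_abs (f := fun x => exp (-(c * x)))]
  have h := integral_comp_mul_left_Ioi (fun x => exp (-x)) 0 hc
  rw [mul_zero, integral_exp_neg_Ioi_zero] at h
  rw [h]
  simp [div_eq_mul_inv]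

variable {ι : Type*} [Fintype ι]

/-- The density of independent standard Laplace variables. -/
def laplaceDensity (z : ι → ℝ) : ℝ := ∏ i, (1 / 2 * exp (-|z i|))

lemma laplaceDensity_nonneg (z : ι → ℝ) : 0 ≤ laplaceDensity z :=
  Finset.prod_nonneg fun _ _ => by positivity

lemma laplaceDensity_sub_le (z c : ι → ℝ) :
    laplaceDensity (z - c) ≤ exp (∑ i, |c i|) * laplaceDensity z := by
  unfold laplaceDensity
  rw [exp_sum, ← Finset.prod_mul_distrib]
  refine Finset.prod_le_prod (fun _ _ => by positivity) fun i _ => ?_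
  have h : exp (-|(z - c) i|) ≤ exp (|c i|) * exp (-|z i|) := by
    rw [← exp_add]
    refine exp_le_exp.mpr ?_
    have := abs_sub_abs_le_abs_sub (z i) (c i)
    simp only [Pi.sub_apply]
    linarith
  linarith

/-- The law of independent standard Laplace variables. -/
def laplaceProd (ι : Type*) [Fintype ι] : Measure (ι → ℝ) :=
  volume.withDensity fun z => ENNReal.ofReal (laplaceDensity z)

lemma integral_laplaceDensity_mul_exp [DecidableEq ι] (I : Finset ι) :
    ∫ z : ι → ℝ, laplaceDensity z * exp ((∑ i ∈ I, |z i|) / 2) = 2 ^ I.card := by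
  have h1 : ∀ z : ι → ℝ, laplaceDensity z * exp ((∑ i ∈ I, |z i|) / 2) =
      ∏ i, (1 / 2 * exp (-((if i ∈ I then 1 / 2 else 1) * |z i|))) := by
    intro z
    have h2 : (∑ i ∈ I, |z i|) / 2 = ∑ i, if i ∈ I then |z i| / 2 else 0 := by
      rw [Finset.sum_div, Finset.sum_ite_mem, Finset.univ_inter]
    rw [h2, exp_sum, laplaceDensity, ← Finset.prod_mul_distrib]
    refine Finset.prod_congr rfl fun i _ => ?_
    rw [mul_assoc, ← exp_add]
    congr 2
    split_ifs <;> ring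
  simp_rw [h1]
  rw [integral_fintype_prod_volume_eq_prod
    (fun (i : ι) (x : ℝ) => 1 / 2 * exp (-((if i ∈ I then 1 / 2 else 1) * |x|)))]
  have h3 : ∀ i, ∫ x : ℝ, 1 / 2 * exp (-((if i ∈ I then 1 / 2 else 1) * |x|)) =
      if i ∈ I then 2 else 1 := by
    intro i
    rw [integral_const_mul, integral_exp_neg_mul_abs (by split_ifs <;> norm_num)]
    split_ifs <;> norm_num
  simp_rw [h3]
  rw [Finset.prod_ite_mem, Finset.univ_inter, Finset.prod_const]

lemma lintegral_laplaceDensity_mul_exp (I : Finset ι) :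
    ∫⁻ z : ι → ℝ, ENNReal.ofReal (laplaceDensity z * exp ((∑ i ∈ I, |z i|) / 2)) =
      ENNReal.ofReal (2 ^ I.card) := by
  classical
  rw [← integral_laplaceDensity_mul_exp I]
  refine (ofReal_integral_eq_lintegral_ofReal (Integrable.of_integral_ne_zero ?_)
    (Filter.Eventually.of_forall fun z => ?_)).symm
  · rw [integral_laplaceDensity_mul_exp]
    positivity
  · exact mul_nonneg (laplaceDensity_nonneg z) (exp_pos _).le

instance : IsProbabilityMeasure (laplaceProd ι) := by
  refine ⟨?_⟩
  rw [laplaceProd, withDensity_apply _ MeasurableSet.univ, Measure.restrict_univ]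
  simpa using lintegral_laplaceDensity_mul_exp (∅ : Finset ι)

lemma laplaceProd_tail_le (I : Finset ι) (x : ℝ) :
    (laplaceProd ι).real {z | x ≤ ∑ i ∈ I, |z i|} ≤ 2 ^ I.card * exp (-(x / 2)) := by
  have hm : MeasurableSet {z : ι → ℝ | x ≤ ∑ i ∈ I, |z i|} :=
    measurableSet_le measurable_const (by fun_prop)
  refine ENNReal.toReal_le_of_le_ofReal (by positivity) ?_
  rw [laplaceProd, withDensity_apply _ hm]
  calc ∫⁻ z in {z : ι → ℝ | x ≤ ∑ i ∈ I, |z i|}, ENNReal.ofReal (laplaceDensity z)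
      ≤ ∫⁻ z in {z : ι → ℝ | x ≤ ∑ i ∈ I, |z i|},
          ENNReal.ofReal (laplaceDensity z * exp ((∑ i ∈ I, |z i|) / 2)) *
            ENNReal.ofReal (exp (-(x / 2))) := by
        refine setLIntegral_mono' hm fun z hz => ?_
        rw [← ENNReal.ofReal_mul (mul_nonneg (laplaceDensity_nonneg z) (exp_pos _).le)]
        refine ENNReal.ofReal_le_ofReal ?_
        rw [mul_assoc, ← exp_add]
        refine le_mul_of_one_le_right (laplaceDensity_nonneg z) (one_le_exp ?_)
        have hz : x ≤ ∑ i ∈ I, |z i| := hz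
        linarith
    _ ≤ ∫⁻ z : ι → ℝ, ENNReal.ofReal (laplaceDensity z * exp ((∑ i ∈ I, |z i|) / 2)) *
          ENNReal.ofReal (exp (-(x / 2))) := setLIntegral_le_lintegral _ _
    _ = ENNReal.ofReal (2 ^ I.card * exp (-(x / 2))) := by
        rw [lintegral_mul_const' _ _ ENNReal.ofReal_ne_top, lintegral_laplaceDensity_mul_exp,
          ← ENNReal.ofReal_mul (by positivity)]

lemma laplaceProd_shift_le {B : Set (ι → ℝ)} (hB : MeasurableSet B) (c : ι → ℝ) :
    (laplaceProd ι).real {z | z + c ∈ B} ≤ exp (∑ i, |c i|) * (laplaceProd ι).real B := by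
  have hm : MeasurableSet {z : ι → ℝ | z + c ∈ B} := hB.preimage (measurable_add_const c)
  have key : laplaceProd ι {z | z + c ∈ B} ≤
      ENNReal.ofReal (exp (∑ i, |c i|)) * laplaceProd ι B := by
    rw [laplaceProd, withDensity_apply _ hm, withDensity_apply _ hB,
      ← lintegral_const_mul' _ _ ENNReal.ofReal_ne_top, ← lintegral_indicator hm,
      ← lintegral_indicator hB,
      ← lintegral_sub_right_eq_self (μ := (volume : Measure (ι → ℝ))) _ c]
    refine lintegral_mono fun z => ?_
    by_cases hz : z ∈ B
    · have hz' : z - c ∈ {z : ι → ℝ | z + c ∈ B} := by simpa using hz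
      simp only [Set.indicator_of_mem hz, Set.indicator_of_mem hz']
      rw [← ENNReal.ofReal_mul (exp_pos _).le]
      exact ENNReal.ofReal_le_ofReal (laplaceDensity_sub_le z c)
    · have hz' : z - c ∉ {z : ι → ℝ | z + c ∈ B} := by simpa using hz
      simp [Set.indicator_of_notMem hz']
  have := ENNReal.toReal_mono (ENNReal.mul_ne_top ENNReal.ofReal_ne_top (measure_ne_top _ _)) key
  rwa [ENNReal.toReal_mul, ENNReal.toReal_ofReal (exp_pos _).le] at this

end Laplace

end

noncomputable section

section Survival

open Real

/-- The accumulated hazard of a monitored sequence `a` after `n` of `T` steps. -/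
def hazard (T : ℕ) (ε : ℝ) (a : ℕ → ℕ) (n : ℕ) : ℝ :=
  ∑ s ∈ Finset.range n, exp (ε / 6 * a (s + 1)) / (200 * T)

/-- The probability that an algorithm of horizon `T` that monitors the sequence `a` runs for at
least `n` steps. -/
def survival (T : ℕ) (ε : ℝ) (a : ℕ → ℕ) (n : ℕ) : ℝ :=
  if n ≤ T then 1 / (1 + hazard T ε a n) else 0

variable {T : ℕ} {ε : ℝ} {a a' : ℕ → ℕ}

lemma hazard_nonneg (n : ℕ) : 0 ≤ hazard T ε a n :=
  Finset.sum_nonneg fun _ _ => by positivity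

lemma hazard_succ (n : ℕ) :
    hazard T ε a (n + 1) = hazard T ε a n + exp (ε / 6 * a (n + 1)) / (200 * T) :=
  Finset.sum_range_succ _ _

lemma hazard_congr {n : ℕ} (h : ∀ k, k ≠ 0 → k ≤ n → a k = a' k) :
    hazard T ε a n = hazard T ε a' n := by
  refine Finset.sum_congr rfl fun s hs => ?_
  rw [h (s + 1) s.succ_ne_zero (Finset.mem_range.mp hs)]

lemma survival_congr {n : ℕ} (h : ∀ k, k ≠ 0 → k ≤ n → a k = a' k) :
    survival T ε a n = survival T ε a' n := by
  rw [survival, survival, hazard_congr h]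

lemma survival_antitone : Antitone (survival T ε a) := by
  refine antitone_nat_of_succ_le fun n => ?_
  unfold survival
  by_cases hn : n + 1 ≤ T
  · rw [if_pos hn, if_pos (by omega), hazard_succ]
    have := hazard_nonneg (T := T) (ε := ε) (a := a) n
    refine one_div_le_one_div_of_le (by linarith) ?_
    have : 0 ≤ exp (ε / 6 * a (n + 1)) / (200 * T) := by positivity
    linarith
  · rw [if_neg hn]
    have := hazard_nonneg (T := T) (ε := ε) (a := a) n
    split_ifs <;> positivity

@[simp] lemma survival_zero : survival T ε a 0 = 1 := by simp [survival, hazard]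

@[simp] lemma survival_succ_horizon : survival T ε a (T + 1) = 0 := by simp [survival]

lemma exp_step_le (hε : 0 < ε) {x y : ℕ} (h : x ≤ y + 1) :
    exp (ε / 6 * x) ≤ exp (ε / 6) * exp (ε / 6 * y) := by
  rw [← exp_add]
  refine exp_le_exp.mpr ?_
  have : (x : ℝ) ≤ y + 1 := by exact_mod_cast h
  nlinarith

lemma hazard_le (hε : 0 < ε) (h : ∀ n, a n ≤ a' n + 1) (n : ℕ) :
    hazard T ε a n ≤ exp (ε / 6) * hazard T ε a' n := by
  unfold hazard
  rw [Finset.mul_sum]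
  refine Finset.sum_le_sum fun s _ => ?_
  rw [← mul_div_assoc]
  exact div_le_div_of_nonneg_right (exp_step_le hε (h _)) (by positivity)

lemma one_div_one_add_hazard_le (hε : 0 < ε) (h' : ∀ n, a' n ≤ a n + 1) (n : ℕ) :
    1 / (1 + hazard T ε a n) ≤ exp (ε / 6) * (1 / (1 + hazard T ε a' n)) := by
  have h1 := hazard_nonneg (T := T) (ε := ε) (a := a) n
  have h2 := hazard_nonneg (T := T) (ε := ε) (a := a') n
  have h3 := hazard_le (T := T) hε h' n
  have h4 : 1 ≤ exp (ε / 6) := one_le_exp (by positivity)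
  rw [mul_one_div, div_le_div_iff₀ (by linarith) (by linarith)]
  nlinarith

lemma survival_sub_le (hε : 0 < ε) (h : ∀ n, a n ≤ a' n + 1) (h' : ∀ n, a' n ≤ a n + 1)
    {n : ℕ} (hn : n ≤ T) :
    survival T ε a n - survival T ε a (n + 1) ≤
      exp (ε / 2) * (survival T ε a' n - survival T ε a' (n + 1)) := by
  have hexp : exp (ε / 2) = exp (ε / 6) * exp (ε / 6) * exp (ε / 6) := by
    rw [← exp_add, ← exp_add]
    congr 1
    ring
  have h4 : 1 ≤ exp (ε / 6) := one_le_exp (by positivity)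
  have hpos : ∀ (c : ℕ → ℕ) n, 0 < 1 + hazard T ε c n := fun c n => by
    have := hazard_nonneg (T := T) (ε := ε) (a := c) n
    linarith
  unfold survival
  by_cases hn' : n + 1 ≤ T
  · simp only [if_pos hn, if_pos hn']
    have hdiff : ∀ c : ℕ → ℕ, 1 / (1 + hazard T ε c n) - 1 / (1 + hazard T ε c (n + 1)) =
        (1 / (1 + hazard T ε c n)) * (1 / (1 + hazard T ε c (n + 1))) *
          (exp (ε / 6 * c (n + 1)) / (200 * T)) := by
      intro c
      have h1 := hpos c n
      have h2 := hpos c (n + 1)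
      have h3 := hazard_succ (T := T) (ε := ε) (a := c) n
      have h4 : exp (ε / 6 * c (n + 1)) / (200 * T) = hazard T ε c (n + 1) - hazard T ε c n := by
        rw [h3]; ring
      rw [h4]
      field_simp
      ring
    rw [hdiff, hdiff, hexp]
    have h1 := one_div_one_add_hazard_le (T := T) hε h' n
    have h2 := one_div_one_add_hazard_le (T := T) hε h' (n + 1)
    have h3 : exp (ε / 6 * a (n + 1)) / (200 * T) ≤
        exp (ε / 6) * (exp (ε / 6 * a' (n + 1)) / (200 * T)) := by
      rw [← mul_div_assoc]
      exact div_le_div_of_nonneg_right (exp_step_le hε (h _)) (by positivity)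
    have p1 := (one_div_pos.mpr (hpos a n)).le
    have p2 := (one_div_pos.mpr (hpos a (n + 1))).le
    have p3 := (one_div_pos.mpr (hpos a' n)).le
    have p4 := (one_div_pos.mpr (hpos a' (n + 1))).le
    refine (mul_le_mul (mul_le_mul h1 h2 p2 (by positivity)) h3 (by positivity)
      (by positivity)).trans (le_of_eq (by ring))
  · simp only [if_pos hn, if_neg hn', sub_zero]
    refine (one_div_one_add_hazard_le hε h' n).trans ?_
    refine mul_le_mul_of_nonneg_right (exp_le_exp.mpr (by linarith))
      (one_div_pos.mpr (hpos a' n)).le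

lemma survival_le (hε : 0 < ε) (hT : 0 < T) {n ℓ : ℕ} (hn0 : n ≠ 0) {δ : ℝ} (hδ : 0 < δ)
    (hℓ : log (200 * T / δ) * (6 / ε) ≤ ℓ) (ha : ℓ ≤ a n) : survival T ε a n ≤ δ := by
  have hT' : (0 : ℝ) < T := by exact_mod_cast hT
  obtain ⟨k, rfl⟩ := Nat.exists_eq_succ_of_ne_zero hn0
  unfold survival
  split_ifs
  · have h1 := hazard_nonneg (T := T) (ε := ε) (a := a) k
    rw [Nat.succ_eq_add_one, hazard_succ]
    have h2 : 1 / δ ≤ exp (ε / 6 * a (k + 1)) / (200 * T) := by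
      rw [le_div_iff₀ (by positivity)]
      have h3 : log (200 * T / δ) ≤ ε / 6 * a (k + 1) := by
        have ha' : (ℓ : ℝ) ≤ a (k + 1) := by exact_mod_cast ha
        have := hℓ.trans ha'
        calc log (200 * T / δ) = ε / 6 * (log (200 * T / δ) * (6 / ε)) := by field_simp
          _ ≤ _ := by gcongr
      calc 1 / δ * (200 * T) = exp (log (200 * T / δ)) := by
            rw [exp_log (by positivity)]; ring
        _ ≤ _ := exp_le_exp.mpr h3
    rw [div_le_iff₀ (by positivity)]
    have : δ * (1 / δ) = 1 := by field_simp
    nlinarith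
  · exact hδ.le

lemma one_sub_survival_le (hT : 0 < T) {n : ℕ} (hn : n ≤ T) (ha : ∀ k, k ≠ 0 → k ≤ n → a k = 0) :
    1 - 1 / 200 ≤ survival T ε a n := by
  have hT' : (0 : ℝ) < T := by exact_mod_cast hT
  have h1 : hazard T ε a n ≤ 1 / 200 := by
    unfold hazard
    calc ∑ s ∈ Finset.range n, exp (ε / 6 * a (s + 1)) / (200 * T)
        = ∑ s ∈ Finset.range n, 1 / (200 * (T : ℝ)) := by
          refine Finset.sum_congr rfl fun s hs => ?_
          rw [ha (s + 1) s.succ_ne_zero (Finset.mem_range.mp hs)]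
          simp
      _ = n * (1 / (200 * (T : ℝ))) := by simp
      _ ≤ T * (1 / (200 * (T : ℝ))) := by
          gcongr
      _ = 1 / 200 := by field_simp
  have h0 := hazard_nonneg (T := T) (ε := ε) (a := a) n
  rw [survival, if_pos hn, le_div_iff₀ (by linarith)]
  nlinarith

end Survival

section Mixture

variable {Z : Type*} [MeasurableSpace Z]

/-- The law of a uniform coin in `[0, 1)`. -/
def uniformCoin : Measure ℝ := volume.restrict (Set.Ico 0 1)

instance : IsProbabilityMeasure uniformCoin := ⟨by simp [uniformCoin]⟩

/-- An event that for a uniform coin in `[s (n + 1), s n)` is decided by `B n`. -/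
lemma uniformCoin_prod_real (μ : Measure Z) [IsProbabilityMeasure μ] {T : ℕ} {s : ℕ → ℝ}
    (hs : Antitone s) (hs0 : s 0 = 1) (hsT : s (T + 1) = 0) {X : Set (ℝ × Z)}
    (hX : MeasurableSet X) {B : ℕ → Set Z} (hB : ∀ n, MeasurableSet (B n))
    (h : ∀ n ≤ T, ∀ u, s (n + 1) ≤ u → u < s n → ∀ z, (u, z) ∈ X ↔ z ∈ B n) :
    (uniformCoin.prod μ).real X =
      ∑ n ∈ Finset.range (T + 1), (s n - s (n + 1)) * μ.real (B n) := by
  have hset : X ∩ (Set.Ico 0 1 ×ˢ Set.univ) =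
      ⋃ n ∈ Finset.range (T + 1), Set.Ico (s (n + 1)) (s n) ×ˢ B n := by
    ext ⟨u, z⟩
    simp only [Set.mem_inter_iff, Set.mem_prod, Set.mem_univ, and_true, Set.mem_iUnion,
      Finset.mem_range, Nat.lt_succ_iff, exists_prop]
    constructor
    · rintro ⟨hu, h0, h1⟩
      have hex : ∃ n, s (n + 1) ≤ u := ⟨T, hsT.trans_le h0⟩
      classical
      have hle : Nat.find hex ≤ T := Nat.find_min' hex (hsT.trans_le h0)
      have hlt : u < s (Nat.find hex) := by
        rcases Nat.eq_zero_or_pos (Nat.find hex) with h2 | h2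
        · rw [h2, hs0]
          exact h1
        · obtain ⟨k, hk⟩ := Nat.exists_eq_succ_of_ne_zero h2.ne'
          rw [hk]
          exact not_le.mp (Nat.find_min hex (by omega : k < Nat.find hex))
      exact ⟨_, hle, ⟨Nat.find_spec hex, hlt⟩,
        (h _ hle u (Nat.find_spec hex) hlt z).mp hu⟩
    · rintro ⟨n, hn, ⟨h1, h2⟩, hz⟩
      refine ⟨(h n hn u h1 h2 z).mpr hz, ?_, ?_⟩
      · exact hsT.symm.trans_le ((hs (by omega)).trans h1)
      · exact h2.trans_le ((hs (Nat.zero_le n)).trans_eq hs0)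
  have hrestr : uniformCoin.prod μ = (volume.prod μ).restrict (Set.Ico 0 1 ×ˢ Set.univ) := by
    rw [uniformCoin, ← Measure.prod_restrict, Measure.restrict_univ]
  have hdisj : Set.PairwiseDisjoint (Finset.range (T + 1) : Set ℕ)
      fun n => Set.Ico (s (n + 1)) (s n) ×ˢ B n := by
    have aux : ∀ a b, a < b → Disjoint (Set.Ico (s (a + 1)) (s a) ×ˢ B a)
        (Set.Ico (s (b + 1)) (s b) ×ˢ B b) := by
      intro a b hab
      refine Set.disjoint_left.mpr ?_
      rintro ⟨u, z⟩ ⟨⟨h1, -⟩, -⟩ ⟨⟨-, h2⟩, -⟩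
      exact absurd (h1.trans_lt h2) (not_lt.mpr (hs hab))
    intro a _ b _ hab
    rcases lt_or_gt_of_ne hab with h1 | h1
    · exact aux a b h1
    · exact (aux b a h1).symm
  rw [measureReal_def, hrestr, Measure.restrict_apply hX, hset,
    measure_biUnion_finset hdisj fun n _ => measurableSet_Ico.prod (hB n), ENNReal.toReal_sum]
  · refine Finset.sum_congr rfl fun n _ => ?_
    rw [Measure.prod_prod, Real.volume_Ico, ENNReal.toReal_mul,
      ENNReal.toReal_ofReal (sub_nonneg.mpr (hs n.le_succ)), measureReal_def]
  · intro n _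
    rw [Measure.prod_prod, Real.volume_Ico]
    exact ENNReal.mul_ne_top ENNReal.ofReal_ne_top (measure_ne_top _ _)

/-- Two mixtures whose weights and whose components are within a factor `c`, except for components
of total weight at most `δ`. -/
lemma mixture_le {T : ℕ} {s s' m m' : ℕ → ℝ} {c δ : ℝ} (hc : 0 ≤ c) (hs : Antitone s)
    (hs' : Antitone s') (hsT : s (T + 1) = 0)
    (hm1 : ∀ n, m n ≤ 1) (hm0 : ∀ n, 0 ≤ m n) (hm' : ∀ n, 0 ≤ m' n) (hδ : 0 ≤ δ)
    (hw : ∀ n ≤ T, s n - s (n + 1) ≤ c * (s' n - s' (n + 1)))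
    {P : ℕ → Prop} (hgood : ∀ n ≤ T, P n → m n ≤ c * m' n) (hbad : ∀ n ≤ T, ¬ P n → s n ≤ δ) :
    ∑ n ∈ Finset.range (T + 1), (s n - s (n + 1)) * m n ≤
      c * c * ∑ n ∈ Finset.range (T + 1), (s' n - s' (n + 1)) * m' n + δ := by
  have hterm : ∀ n ≤ T, P n →
      (s n - s (n + 1)) * m n ≤ c * c * ((s' n - s' (n + 1)) * m' n) := by
    intro n hn hP
    have h0 : 0 ≤ s' n - s' (n + 1) := sub_nonneg.mpr (hs' n.le_succ)
    exact (mul_le_mul (hw n hn) (hgood n hn hP) (hm0 n) (by positivity)).trans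
      (le_of_eq (by ring))
  have hnn : ∀ n, 0 ≤ c * c * ((s' n - s' (n + 1)) * m' n) := fun n => by
    have h0 : 0 ≤ s' n - s' (n + 1) := sub_nonneg.mpr (hs' n.le_succ)
    have := hm' n
    positivity
  rw [Finset.mul_sum]
  by_cases hall : ∀ n ≤ T, P n
  · have := Finset.sum_le_sum (s := Finset.range (T + 1)) fun n hn =>
      hterm n (Nat.lt_succ_iff.mp (Finset.mem_range.mp hn))
        (hall n (Nat.lt_succ_iff.mp (Finset.mem_range.mp hn)))
    linarith
  · push Not at hall
    classical
    obtain ⟨hkT, hkP⟩ := Nat.find_spec hall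
    set k := Nat.find hall with hk
    have hlt : ∀ n < k, P n := fun n hn => by
      have := Nat.find_min hall hn
      push Not at this
      exact this (by omega)
    rw [← Finset.sum_range_add_sum_Ico _ (by omega : k ≤ T + 1),
      ← Finset.sum_range_add_sum_Ico (fun n => c * c * ((s' n - s' (n + 1)) * m' n))
        (by omega : k ≤ T + 1)]
    have h1 : ∑ n ∈ Finset.range k, (s n - s (n + 1)) * m n ≤
        ∑ n ∈ Finset.range k, c * c * ((s' n - s' (n + 1)) * m' n) :=
      Finset.sum_le_sum fun n hn => by
        have hn := Finset.mem_range.mp hn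
        exact hterm n (by omega) (hlt n hn)
    have h2 : ∑ n ∈ Finset.Ico k (T + 1), (s n - s (n + 1)) * m n ≤ δ := by
      calc ∑ n ∈ Finset.Ico k (T + 1), (s n - s (n + 1)) * m n
          ≤ ∑ n ∈ Finset.Ico k (T + 1), (s n - s (n + 1)) :=
            Finset.sum_le_sum fun n _ =>
              mul_le_of_le_one_right (sub_nonneg.mpr (hs n.le_succ)) (hm1 n)
        _ = -∑ n ∈ Finset.Ico k (T + 1), (s (n + 1) - s n) := by
            rw [← Finset.sum_neg_distrib]
            exact Finset.sum_congr rfl fun _ _ => (neg_sub _ _).symm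
        _ = s k := by rw [Finset.sum_Ico_sub _ (by omega : k ≤ T + 1), hsT]; ring
        _ ≤ δ := hbad k hkT hkP
    have h3 : 0 ≤ ∑ n ∈ Finset.Ico k (T + 1), c * c * ((s' n - s' (n + 1)) * m' n) :=
      Finset.sum_nonneg fun n _ => hnn n
    linarith

end Mixture

end

noncomputable section

section TreeNoise

variable {κ : Type} {L T : ℕ}

/-- The noise that the binary tree mechanism with `L` levels adds to coordinate `i` after `n`
steps: one term for every level. -/
def treeNoise (z : κ × Fin L × Fin (T + 1) → ℝ) (i : κ) (n : ℕ) : ℝ :=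
  ∑ j : Fin L, z (i, j, Fin.ofNat (T + 1) (n / 2 ^ (j : ℕ)))

lemma measurable_treeNoise (i : κ) (n : ℕ) :
    Measurable fun z : κ × Fin L × Fin (T + 1) → ℝ => treeNoise z i n := by
  unfold treeNoise
  fun_prop

/-- The change of the tree noise that compensates for the change `g` of the exact values. -/
def treeShift (b : ℝ) (g : ℕ → κ → ℝ) : κ × Fin L × Fin (T + 1) → ℝ :=
  fun p => dyadicShift (fun n => g n p.1) p.2.1 p.2.2 / b

lemma mul_treeNoise_add_treeShift {b : ℝ} (hb : b ≠ 0) {g : ℕ → κ → ℝ} (hg : g 0 = 0)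
    (hT : T < 2 ^ L) (z : κ × Fin L × Fin (T + 1) → ℝ) (i : κ) {n : ℕ} (hn : n ≤ T) :
    b * treeNoise (z + treeShift b g) i n = g n i + b * treeNoise z i n := by
  have h1 : ∑ j : Fin L, dyadicShift (fun n => g n i) j (n / 2 ^ (j : ℕ)) = g n i := by
    rw [Fin.sum_univ_eq_sum_range fun j => dyadicShift (fun n => g n i) j (n / 2 ^ j)]
    exact sum_dyadicShift (by simp [hg]) (hn.trans_lt hT)
  unfold treeNoise
  rw [← h1, Finset.mul_sum, Finset.mul_sum, ← Finset.sum_add_distrib]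
  refine Finset.sum_congr rfl fun j _ => ?_
  have h2 : n / 2 ^ (j : ℕ) % (T + 1) = n / 2 ^ (j : ℕ) :=
    Nat.mod_eq_of_lt (Nat.lt_succ_of_le ((Nat.div_le_self _ _).trans hn))
  rw [Pi.add_apply, treeShift]
  simp only [Fin.ofNat, h2]
  field_simp
  ring

lemma sum_abs_treeShift_le [Fintype κ] {b Δ : ℝ} (hb : 0 < b) {g : ℕ → κ → ℝ} {N : ℕ}
    (hN : ∀ n, N ≤ n → g n = g N) (hΔ : ∑ i, seqVariation N (fun n => g n i) ≤ Δ) :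
    ∑ p : κ × Fin L × Fin (T + 1), |treeShift b g p| ≤ L * Δ / b := by
  rw [Fintype.sum_prod_type]
  have h1 : ∀ i : κ, ∑ q : Fin L × Fin (T + 1), |treeShift b g (i, q)| ≤
      L * seqVariation N (fun n => g n i) / b := by
    intro i
    rw [Fintype.sum_prod_type]
    calc ∑ j : Fin L, ∑ m : Fin (T + 1), |treeShift b g (i, j, m)|
        ≤ ∑ j : Fin L, seqVariation N (fun n => g n i) / b := by
          refine Finset.sum_le_sum fun j _ => ?_
          have h2 : ∀ m : Fin (T + 1), |treeShift b g (i, j, m)| =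
              |dyadicShift (fun n => g n i) j m| / b := fun m => by
            rw [treeShift, abs_div, abs_of_pos hb]
          simp_rw [h2]
          rw [← Finset.sum_div,
            Fin.sum_univ_eq_sum_range fun m => |dyadicShift (fun n => g n i) j m|]
          refine div_le_div_of_nonneg_right ?_ hb.le
          exact sum_abs_dyadicShift_le _ (fun n hn => by rw [hN n hn]) _ _
      _ = L * seqVariation N (fun n => g n i) / b := by
          rw [Finset.sum_const, Finset.card_univ, Fintype.card_fin, nsmul_eq_mul, mul_div_assoc]
  refine (Finset.sum_le_sum fun i _ => h1 i).trans ?_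
  rw [← Finset.sum_div, ← Finset.mul_sum]
  gcongr

lemma treeNoise_tail_le [Fintype κ] (i : κ) (n : ℕ) (x : ℝ) :
    (laplaceProd (κ × Fin L × Fin (T + 1))).real {z | x ≤ |treeNoise z i n|} ≤
      2 ^ L * Real.exp (-(x / 2)) := by
  classical
  set e : Fin L → κ × Fin L × Fin (T + 1) :=
    fun j => (i, j, Fin.ofNat (T + 1) (n / 2 ^ (j : ℕ))) with he
  have hinj : Function.Injective e := fun j k hjk => by
    simp only [he, Prod.mk.injEq] at hjk
    exact hjk.2.1
  have h := laplaceProd_tail_le (Finset.univ.image e) x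
  rw [Finset.card_image_of_injective _ hinj, Finset.card_univ, Fintype.card_fin] at h
  refine le_trans (measureReal_mono fun z hz => ?_) h
  rw [Set.mem_ofPred_eq, Finset.sum_image fun j _ k _ hjk => hinj hjk]
  exact le_trans hz (Finset.abs_sum_le_sum_abs _ _)

end TreeNoise

/-- A family `F` of vector-valued statistics of graph streams, indexed by the number of steps that
have been processed, together with an integer count `h`.  Both are functions of the past, the count
is `1`-Lipschitz with respect to node-neighbors, and the `ℓ₁`-variation of the difference of `F` on
node-neighbors is at most `Δ` as long as the count is at most `ℓ`. -/
structure IsStable {V : Type u} {T : ℕ} {κ : Type} [Fintype κ] (ℓ : ℕ) (Δ : ℝ)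
    (F : GraphStream V T → ℕ → κ → ℝ) (h : GraphStream V T → ℕ → ℕ) : Prop where
  value_online : ∀ (S S' : GraphStream V T) (n : ℕ),
    (∀ s : Fin T, (s : ℕ) < n → S.nodes s = S'.nodes s ∧ S.edges s = S'.edges s) →
      F S n = F S' n
  count_online : ∀ (S S' : GraphStream V T) (n : ℕ),
    (∀ s : Fin T, (s : ℕ) < n → S.nodes s = S'.nodes s ∧ S.edges s = S'.edges s) →
      h S n = h S' n
  count_zero : ∀ S, h S 0 = 0
  value_zero : ∀ S, F S 0 = 0
  count_le : ∀ S S' : GraphStream V T, S.NodeNeighbor S' → ∀ n, h S n ≤ h S' n + 1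
  variation_le : ∀ S S' : GraphStream V T, S.NodeNeighbor S' → ∀ N ≤ T, h S N ≤ ℓ →
    ∑ i, seqVariation N (fun n => F S n i - F S' n i) ≤ Δ

section Mechanism

variable {V : Type u} {T : ℕ} {κ : Type} {Y : Type} [MeasurableSpace Y]

/-- The values `F` with tree noise of scale `b`, released for `n` steps. -/
def stoppedRelease (F : ℕ → κ → ℝ) (φ : (κ → ℝ) → Y) (L : ℕ) (b : ℝ) (n : ℕ)
    (z : κ × Fin L × Fin (T + 1) → ℝ) : Fin T → Y :=
  fun t => if (t : ℕ) < n then φ (fun i => F (t + 1) i + b * treeNoise z i (t + 1)) else φ 0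

lemma measurable_stoppedRelease (F : ℕ → κ → ℝ) {φ : (κ → ℝ) → Y} (hφ : Measurable φ) (L : ℕ)
    (b : ℝ) (n : ℕ) : Measurable (stoppedRelease (T := T) F φ L b n) := by
  refine measurable_pi_lambda _ fun t => ?_
  unfold stoppedRelease
  split_ifs
  · refine hφ.comp (measurable_pi_lambda _ fun i => ?_)
    exact measurable_const.add (measurable_const.mul (measurable_treeNoise i _))
  · exact measurable_const

variable [Fintype κ] {ℓ : ℕ} {Δ : ℝ} {F : GraphStream V T → ℕ → κ → ℝ}
  {h : GraphStream V T → ℕ → ℕ}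

/-- The binary tree mechanism for the statistic `F`, which stops at a random time that becomes
likely when the count `h` grows. -/
def stoppedTreeAlg (hst : IsStable ℓ Δ F h) {φ : (κ → ℝ) → Y} (hφ : Measurable φ) (L : ℕ)
    (ε b : ℝ) : ContinualAlg V T Y where
  Coins := ℝ × (κ × Fin L × Fin (T + 1) → ℝ)
  coinLaw := uniformCoin.prod (laplaceProd _)
  output S ω t := if ω.1 < survival T ε (h S) (t + 1) then
    φ (fun i => F S (t + 1) i + b * treeNoise ω.2 i (t + 1)) else φ 0
  measurable_output S := by
    refine measurable_pi_lambda _ fun t => Measurable.ite ?_ ?_ measurable_const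
    · exact measurableSet_lt measurable_fst measurable_const
    · refine hφ.comp (measurable_pi_lambda _ fun i => ?_)
      exact measurable_const.add
        (measurable_const.mul ((measurable_treeNoise i _).comp measurable_snd))
  online S S' t hSS' ω := by
    have h1 : F S (t + 1) = F S' (t + 1) := hst.value_online S S' _ fun s hs =>
      hSS' s (Fin.le_def.mpr (Nat.lt_succ_iff.mp hs))
    have h2 : survival T ε (h S) (t + 1) = survival T ε (h S') (t + 1) :=
      survival_congr fun k _ hk => hst.count_online S S' k fun s hs =>
        hSS' s (Fin.le_def.mpr (Nat.lt_succ_iff.mp (hs.trans_le hk)))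
    simp only [h1, h2]

lemma stoppedTreeAlg_outputLaw_real (hst : IsStable ℓ Δ F h) {φ : (κ → ℝ) → Y}
    (hφ : Measurable φ) (L : ℕ) (ε b : ℝ) (S : GraphStream V T) {A : Set (Fin T → Y)}
    (hA : MeasurableSet A) :
    ((stoppedTreeAlg hst hφ L ε b).outputLaw S).real A =
      ∑ n ∈ Finset.range (T + 1), (survival T ε (h S) n - survival T ε (h S) (n + 1)) *
        (laplaceProd (κ × Fin L × Fin (T + 1))).real {z | stoppedRelease (F S) φ L b n z ∈ A} := by
  have hmeas := (stoppedTreeAlg hst hφ L ε b).measurable_output S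
  rw [ContinualAlg.outputLaw, map_measureReal_apply hmeas hA]
  refine uniformCoin_prod_real _ survival_antitone survival_zero survival_succ_horizon
    (hmeas hA) (fun n => measurable_stoppedRelease (F S) hφ L b n hA) ?_
  intro n _ u h1 h2 z
  have : (stoppedTreeAlg hst hφ L ε b).output S (u, z) = stoppedRelease (F S) φ L b n z := by
    funext t
    have hiff : u < survival T ε (h S) (t + 1) ↔ (t : ℕ) < n := by
      constructor
      · intro hu
        by_contra hlt
        exact absurd (h1.trans_lt hu)
          (not_lt.mpr (survival_antitone (by omega : n + 1 ≤ (t : ℕ) + 1)))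
      · intro hlt
        exact h2.trans_le (survival_antitone hlt)
    simp only [stoppedTreeAlg, stoppedRelease, hiff]
  change (stoppedTreeAlg hst hφ L ε b).output S (u, z) ∈ A ↔ stoppedRelease (F S) φ L b n z ∈ A
  rw [this]

lemma stoppedRelease_real_le {φ : (κ → ℝ) → Y} (hφ : Measurable φ) {L : ℕ} (hT : T < 2 ^ L)
    {F F' : ℕ → κ → ℝ} (h0 : F 0 = 0) (h0' : F' 0 = 0) {b c : ℝ} (hb : 0 < b) {N : ℕ}
    (hvar : ∑ i, seqVariation N (fun n => F n i - F' n i) ≤ Δ)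
    (hc : L * Δ / b ≤ c) {A : Set (Fin T → Y)} (hA : MeasurableSet A) :
    (laplaceProd (κ × Fin L × Fin (T + 1))).real {z | stoppedRelease F φ L b N z ∈ A} ≤
      Real.exp c * (laplaceProd (κ × Fin L × Fin (T + 1))).real
        {z | stoppedRelease F' φ L b N z ∈ A} := by
  set g : ℕ → κ → ℝ := fun n => F (min n N) - F' (min n N) with hg
  have hg0 : g 0 = 0 := by simp [hg, h0, h0']
  have hshift : ∀ z, stoppedRelease F φ L b N z =
      stoppedRelease (T := T) F' φ L b N (z + treeShift b g) := by
    intro z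
    funext t
    simp only [stoppedRelease]
    split_ifs with ht
    · congr 1
      funext i
      rw [mul_treeNoise_add_treeShift hb.ne' hg0 hT z i t.2]
      simp only [hg, min_eq_left (by omega : (t : ℕ) + 1 ≤ N), Pi.sub_apply]
      ring
    · rfl
  have hsum : ∑ p : κ × Fin L × Fin (T + 1), |treeShift b g p| ≤ c := by
    refine le_trans (sum_abs_treeShift_le hb (N := N) ?_ ?_) hc
    · intro n hn
      simp [hg, hn]
    · refine le_trans (le_of_eq (Finset.sum_congr rfl fun i _ => ?_)) hvar
      refine seqVariation_congr fun n hn => ?_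
      simp [hg, hn]
  have hset : {z | stoppedRelease F φ L b N z ∈ A} =
      {z | z + treeShift b g ∈ {z | stoppedRelease (T := T) F' φ L b N z ∈ A}} := by
    ext z
    simp only [Set.mem_ofPred_eq, hshift z]
  rw [hset]
  refine (laplaceProd_shift_le (measurable_stoppedRelease F' hφ L b N hA) _).trans ?_
  exact mul_le_mul_of_nonneg_right (Real.exp_le_exp.mpr hsum) measureReal_nonneg

lemma GraphStream.NodeNeighbor.symm {S S' : GraphStream V T} (hSS' : S.NodeNeighbor S') :
    S'.NodeNeighbor S := Or.symm hSS'

theorem stoppedTreeAlg_isNodeDP (hst : IsStable ℓ Δ F h) {φ : (κ → ℝ) → Y} (hφ : Measurable φ)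
    {L : ℕ} (hT0 : 0 < T) (hT : T < 2 ^ L) {ε δ b : ℝ} (hε : 0 < ε) (hδ : 0 < δ) (hb : 0 < b)
    (hbΔ : L * Δ / b ≤ ε / 2) (hℓ : Real.log (200 * T / δ) * (6 / ε) ≤ ℓ) :
    (stoppedTreeAlg hst hφ L ε b).IsNodeDP ε δ := by
  have key : ∀ S S' : GraphStream V T, S.NodeNeighbor S' → ∀ A : Set (Fin T → Y),
      MeasurableSet A → ((stoppedTreeAlg hst hφ L ε b).outputLaw S).real A ≤
        Real.exp ε * ((stoppedTreeAlg hst hφ L ε b).outputLaw S').real A + δ := by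
    intro S S' hSS' A hA
    rw [stoppedTreeAlg_outputLaw_real hst hφ L ε b S hA,
      stoppedTreeAlg_outputLaw_real hst hφ L ε b S' hA,
      show Real.exp ε = Real.exp (ε / 2) * Real.exp (ε / 2) by rw [← Real.exp_add]; ring_nf]
    refine mixture_le (P := fun n => h S n ≤ ℓ) (Real.exp_pos _).le survival_antitone
      survival_antitone survival_succ_horizon (fun _ => measureReal_le_one)
      (fun _ => measureReal_nonneg) (fun _ => measureReal_nonneg) hδ.le ?_ ?_ ?_
    · intro n hn
      exact survival_sub_le hε (hst.count_le S S' hSS') (hst.count_le S' S hSS'.symm) hn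
    · intro n hn hgood
      exact stoppedRelease_real_le hφ hT (hst.value_zero S) (hst.value_zero S') hb
        (hst.variation_le S S' hSS' n hn hgood) hbΔ hA
    · intro n _ hbad
      refine survival_le hε hT0 (fun h0 => hbad ?_) hδ hℓ (not_le.mp hbad).le
      rw [h0, hst.count_zero]
      exact Nat.zero_le _
  exact fun S S' hSS' A hA => ⟨key S S' hSS' A hA, key S' S hSS'.symm A hA⟩

theorem stoppedTreeAlg_accurate [Nonempty κ] (hst : IsStable ℓ Δ F h) {φ : (κ → ℝ) → Y}
    (hφ : Measurable φ) {L : ℕ} (hT0 : 0 < T) {ε b : ℝ} (hb : 0 < b) (S : GraphStream V T) :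
    (0.99 : ℝ) ≤ (stoppedTreeAlg hst hφ L ε b).coinLaw.real
      {ω | ∀ t : Fin T, (∀ n ≤ (t : ℕ) + 1, h S n = 0) →
        ∃ y : κ → ℝ, (stoppedTreeAlg hst hφ L ε b).output S ω t = φ y ∧
          ∀ i, |y i - F S (t + 1) i| ≤
            b * (2 * Real.log (200 * T * Fintype.card κ * 2 ^ L))} := by
  set x : ℝ := 2 * Real.log (200 * T * Fintype.card κ * 2 ^ L) with hx
  set μ := laplaceProd (κ × Fin L × Fin (T + 1)) with hμ
  set good : Set (ℝ × (κ × Fin L × Fin (T + 1) → ℝ)) :=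
    {ω | ∀ t : Fin T, (∀ n ≤ (t : ℕ) + 1, h S n = 0) → ∃ y : κ → ℝ,
      (stoppedTreeAlg hst hφ L ε b).output S ω t = φ y ∧
        ∀ i, |y i - F S (t + 1) i| ≤ b * x} with hgood
  change (0.99 : ℝ) ≤ (uniformCoin.prod μ).real good
  set B1 : Set (ℝ × (κ × Fin L × Fin (T + 1) → ℝ)) := Set.Ici (1 - 1 / 200) ×ˢ Set.univ with hB1
  set B2 : Set (ℝ × (κ × Fin L × Fin (T + 1) → ℝ)) :=
    Set.univ ×ˢ ⋃ p ∈ (Finset.univ : Finset (Fin T × κ)),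
      {z | x ≤ |treeNoise z p.2 ((p.1 : ℕ) + 1)|} with hB2
  have hcover : Set.univ ⊆ good ∪ (B1 ∪ B2) := by
    rintro ⟨u, z⟩ -
    by_contra hnot
    simp only [Set.mem_union, not_or] at hnot
    obtain ⟨hng, hn1, hn2⟩ := hnot
    refine hng fun t ht => ?_
    have hu : u < 1 - 1 / 200 := not_le.mp fun hu => hn1 ⟨hu, Set.mem_univ z⟩
    have hz : ∀ (t : Fin T) (i : κ), |treeNoise z i ((t : ℕ) + 1)| < x := by
      simpa [hB2] using hn2
    have hs : u < survival T ε (h S) (t + 1) :=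
      hu.trans_le (one_sub_survival_le hT0 t.2 fun k _ hk => ht k hk)
    refine ⟨fun i => F S (t + 1) i + b * treeNoise z i (t + 1), ?_, fun i => ?_⟩
    · simp only [stoppedTreeAlg, if_pos hs]
    · rw [add_sub_cancel_left, abs_mul, abs_of_pos hb]
      exact mul_le_mul_of_nonneg_left (hz t i).le hb.le
  have hp1 : (uniformCoin.prod μ).real B1 ≤ 1 / 200 := by
    rw [hB1, measureReal_prod_prod, probReal_univ, mul_one, uniformCoin, measureReal_def,
      Measure.restrict_apply measurableSet_Ici]
    have : Set.Ici (1 - 1 / 200 : ℝ) ∩ Set.Ico 0 1 = Set.Ico (1 - 1 / 200) 1 := by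
      ext v
      simp only [Set.mem_inter_iff, Set.mem_Ici, Set.mem_Ico]
      constructor
      · rintro ⟨h1, h2, h3⟩
        exact ⟨h1, h3⟩
      · rintro ⟨h1, h2⟩
        exact ⟨h1, by linarith, h2⟩
    rw [this, Real.volume_Ico]
    norm_num
  have hp2 : (uniformCoin.prod μ).real B2 ≤ 1 / 200 := by
    rw [hB2, measureReal_prod_prod, probReal_univ, one_mul]
    refine (measureReal_biUnion_finset_le _ _).trans ?_
    refine (Finset.sum_le_sum fun p _ => treeNoise_tail_le p.2 _ x).trans ?_
    have hT' : (0 : ℝ) < T := by exact_mod_cast hT0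
    have hκ : (0 : ℝ) < Fintype.card κ := by exact_mod_cast Fintype.card_pos
    rw [Finset.sum_const, Finset.card_univ, Fintype.card_prod, Fintype.card_fin, nsmul_eq_mul, hx,
      mul_div_cancel_left₀ _ two_ne_zero, Real.exp_neg, Real.exp_log (by positivity)]
    push_cast
    refine le_of_eq ?_
    field_simp
  have h1 : (1 : ℝ) ≤ (uniformCoin.prod μ).real good +
      ((uniformCoin.prod μ).real B1 + (uniformCoin.prod μ).real B2) := by
    calc (1 : ℝ) = (uniformCoin.prod μ).real Set.univ := by simp
      _ ≤ (uniformCoin.prod μ).real (good ∪ (B1 ∪ B2)) := measureReal_mono hcover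
      _ ≤ _ := (measureReal_union_le _ _).trans
          (add_le_add_right (measureReal_union_le _ _) _)
  norm_num at hp1 hp2 ⊢
  linarith

end Mechanism

end

noncomputable section

section GraphFamilies

variable {V : Type u}

/-- Two increasing families of finite graphs of degree at most `d`.  The vertices of the second
family are those of the first except for `x`, and through time `N` the edges are the same except
for those in `B`. -/
structure AgreeOff (N d : ℕ) (x : V) (B : Finset (Sym2 V)) (P P' : ℕ → GraphOn V) : Prop where
  mono : Monotone P
  mono' : Monotone P'
  finite : ∀ n, (P n).verts.Finite
  finite' : ∀ n, (P' n).verts.Finite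
  deg_le : ∀ n v, GraphOn.deg (P n) v ≤ d
  deg_le' : ∀ n v, GraphOn.deg (P' n) v ≤ d
  verts_eq : ∀ n, (P' n).verts = (P n).verts \ {x}
  edges_iff : ∀ n ≤ N, ∀ e ∉ B, e ∈ (P n).edgeSet ↔ e ∈ (P' n).edgeSet

lemma GraphOn.finite_neighborSet {G : GraphOn V} (hG : G.verts.Finite) (v : V) :
    (G.neighborSet v).Finite :=
  hG.subset (G.neighborSet_subset_verts v)

lemma GraphOn.finite_edgeSet {G : GraphOn V} (hG : G.verts.Finite) : G.edgeSet.Finite := by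
  refine ((hG.prod hG).image fun p => s(p.1, p.2)).subset fun e he => ?_
  induction e using Sym2.ind with
  | _ a b => exact ⟨(a, b), ⟨G.edge_vert he, G.edge_vert he.symm⟩, rfl⟩

variable {N d : ℕ} {x : V} {B : Finset (Sym2 V)} {P P' : ℕ → GraphOn V}

/-- Counting patterns that are determined by their edges, when every edge of a graph of degree at
most `d` is in at most `c` patterns. -/
lemma AgreeOff.seqVariation_pattern_le (h : AgreeOff N d x B P P') {α : Type*}
    (X : GraphOn V → Set α) (es : α → Set (Sym2 V)) (base : α → Prop) (c : ℕ)
    (hX : ∀ G y, y ∈ X G ↔ base y ∧ ∀ e ∈ es y, e ∈ G.edgeSet)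
    (hfin : ∀ G : GraphOn V, G.verts.Finite → (X G).Finite)
    (hc : ∀ G : GraphOn V, G.verts.Finite → (∀ v, GraphOn.deg G v ≤ d) → ∀ e,
      {y ∈ X G | e ∈ es y}.ncard ≤ c) :
    seqVariation N (fun n => ((X (P n)).ncard : ℝ) - (X (P' n)).ncard) ≤ 4 * (c * B.card) := by
  have hmono : ∀ G H : GraphOn V, G ≤ H → X G ⊆ X H := fun G H hGH y hy => by
    rw [hX] at hy ⊢
    exact ⟨hy.1, fun e he => SimpleGraph.Subgraph.edgeSet_mono hGH (hy.2 e he)⟩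
  set Z : Sym2 V → Set α := fun e =>
    {y ∈ X (P N) | e ∈ es y} ∪ {y ∈ X (P' N) | e ∈ es y} with hZ
  have hZfin : ∀ e, (Z e).Finite := fun e =>
    ((hfin _ (h.finite N)).subset fun _ hy => hy.1).union
      ((hfin _ (h.finite' N)).subset fun _ hy => hy.1)
  have hYfin : (⋃ e ∈ B, Z e).Finite := B.finite_toSet.biUnion fun e _ => hZfin e
  have hYcard : (⋃ e ∈ B, Z e).ncard ≤ B.card * (c + c) := by
    refine (Finset.set_ncard_biUnion_le B Z).trans ?_
    rw [← smul_eq_mul]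
    refine Finset.sum_le_card_nsmul _ _ _ fun e _ => (Set.ncard_union_le _ _).trans ?_
    exact add_le_add (hc _ (h.finite N) (h.deg_le N) e) (hc _ (h.finite' N) (h.deg_le' N) e)
  refine (seqVariation_ncard_sub_le (fun i j hij => hmono _ _ (h.mono hij))
    (fun i j hij => hmono _ _ (h.mono' hij)) (fun n => hfin _ (h.finite n))
    (fun n => hfin _ (h.finite' n)) hYfin ?_).trans ?_
  · intro n hn y hy
    constructor
    · intro hyX
      have h1 := (hX _ _).mp hyX
      refine (hX _ _).mpr ⟨h1.1, fun e he => ?_⟩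
      by_cases heB : e ∈ B
      · exact absurd (Set.mem_biUnion heB (Or.inl ⟨hmono _ _ (h.mono hn) hyX, he⟩)) hy
      · exact (h.edges_iff n hn e heB).mp (h1.2 e he)
    · intro hyX
      have h1 := (hX _ _).mp hyX
      refine (hX _ _).mpr ⟨h1.1, fun e he => ?_⟩
      by_cases heB : e ∈ B
      · exact absurd (Set.mem_biUnion heB (Or.inr ⟨hmono _ _ (h.mono' hn) hyX, he⟩)) hy
      · exact (h.edges_iff n hn e heB).mpr (h1.2 e he)
  · have : ((⋃ e ∈ B, Z e).ncard : ℝ) ≤ B.card * (c + c) := by exact_mod_cast hYcard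
    linarith

lemma AgreeOff.seqVariation_numEdges_le (h : AgreeOff N d x B P P') :
    seqVariation N (fun n => GraphOn.numEdges (P n) - GraphOn.numEdges (P' n)) ≤
      4 * B.card := by
  have := h.seqVariation_pattern_le (fun G => G.edgeSet) (fun e => {e}) (fun _ => True) 1
    (by simp) (fun G hG => GraphOn.finite_edgeSet hG) (fun G _ _ e => by
      refine (Set.ncard_le_ncard (t := {e}) ?_).trans_eq (Set.ncard_singleton e)
      rintro y ⟨-, hy⟩
      exact (Set.mem_singleton_iff.mp hy).symm)
  simpa [GraphOn.numEdges] using this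

lemma AgreeOff.seqVariation_numTriangles_le (h : AgreeOff N d x B P P') :
    seqVariation N (fun n => GraphOn.numTriangles (P n) - GraphOn.numTriangles (P' n)) ≤
      4 * (d * B.card) := by
  classical
  refine h.seqVariation_pattern_le
    (fun G => {s : Finset V | s.card = 3 ∧ ∀ u ∈ s, ∀ v ∈ s, u ≠ v → G.Adj u v})
    (fun s => {e | ∃ u ∈ s, ∃ v ∈ s, u ≠ v ∧ s(u, v) = e}) (fun s => s.card = 3) d ?_ ?_ ?_
  · intro G s
    refine and_congr_right fun _ => ⟨?_, ?_⟩
    · rintro hs e ⟨u, hu, v, hv, huv, rfl⟩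
      exact hs u hu v hv huv
    · intro hs u hu v hv huv
      exact hs s(u, v) ⟨u, hu, v, hv, huv, rfl⟩
  · intro G hG
    refine (hG.toFinset.powerset.finite_toSet).subset fun s hs => ?_
    simp only [Finset.coe_powerset, Set.mem_preimage, Set.mem_powerset_iff, Finset.coe_subset]
    intro u hu
    obtain ⟨v, hv, hvu⟩ := Finset.exists_mem_ne (by rw [hs.1]; norm_num : 1 < s.card) u
    simpa using G.edge_vert (hs.2 u hu v hv hvu.symm)
  · intro G hG hdeg e
    induction e using Sym2.ind with
    | _ a b =>
      refine le_trans (le_trans (Set.ncard_le_ncard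
        (t := (fun w => ({a, b, w} : Finset V)) '' G.neighborSet a) ?_
        ((GraphOn.finite_neighborSet hG a).image _))
        (Set.ncard_image_le (GraphOn.finite_neighborSet hG a))) (hdeg a)
      rintro s ⟨⟨hcard, hadj⟩, u, hu, v, hv, huv, he⟩
      have hab : a ∈ s ∧ b ∈ s ∧ a ≠ b := by
        rcases Sym2.eq_iff.mp he with ⟨rfl, rfl⟩ | ⟨rfl, rfl⟩
        · exact ⟨hu, hv, huv⟩
        · exact ⟨hv, hu, huv.symm⟩
      obtain ⟨ha, hb, hne⟩ := hab
      have hsub : ({a, b} : Finset V) ⊆ s := by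
        intro y hy
        rcases Finset.mem_insert.mp hy with rfl | hy
        · exact ha
        · rwa [Finset.mem_singleton.mp hy]
      obtain ⟨w, hw⟩ : (s \ {a, b}).Nonempty := by
        rw [← Finset.card_pos, Finset.card_sdiff_of_subset hsub, hcard, Finset.card_pair hne]
        norm_num
      obtain ⟨hws, hwab⟩ := Finset.mem_sdiff.mp hw
      simp only [Finset.mem_insert, Finset.mem_singleton, not_or] at hwab
      refine ⟨w, hadj a ha w hws (Ne.symm hwab.1), ?_⟩
      refine Finset.eq_of_subset_of_card_le ?_ ?_
      · intro y hy
        simp only [Finset.mem_insert, Finset.mem_singleton] at hy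
        rcases hy with rfl | rfl | rfl <;> assumption
      · rw [hcard, Finset.card_eq_three.mpr ⟨a, b, w, hne, Ne.symm hwab.1, Ne.symm hwab.2, rfl⟩]

lemma AgreeOff.seqVariation_numStars_le (h : AgreeOff N d x B P P') {k : ℕ} (hk : 1 ≤ k) :
    seqVariation N (fun n => GraphOn.numStars k (P n) - GraphOn.numStars k (P' n)) ≤
      4 * (2 * d ^ (k - 1) * B.card) := by
  classical
  have := h.seqVariation_pattern_le
    (fun G => {p : V × Finset V | p.1 ∈ G.verts ∧ p.2.card = k ∧ ∀ u ∈ p.2, G.Adj p.1 u})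
    (fun p => {e | ∃ u ∈ p.2, s(p.1, u) = e}) (fun p => p.2.card = k) (2 * d ^ (k - 1)) ?_ ?_ ?_
  · simpa [GraphOn.numStars] using this
  · rintro G ⟨c, A⟩
    simp only [Set.mem_ofPred_eq]
    constructor
    · rintro ⟨-, hA, hadj⟩
      refine ⟨hA, ?_⟩
      rintro e ⟨u, hu, rfl⟩
      exact hadj u hu
    · rintro ⟨hA, hadj⟩
      have hadj' : ∀ u ∈ A, G.Adj c u := fun u hu => hadj s(c, u) ⟨u, hu, rfl⟩
      obtain ⟨u, hu⟩ := Finset.card_pos.mp (by omega : 0 < A.card)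
      exact ⟨G.edge_vert (hadj' u hu), hA, hadj'⟩
  · intro G hG
    refine ((hG.toFinset ×ˢ hG.toFinset.powerset).finite_toSet).subset ?_
    rintro ⟨c, A⟩ ⟨hc, -, hadj⟩
    simp only [Finset.coe_product, Set.mem_prod, Finset.mem_coe, Set.Finite.mem_toFinset,
      Finset.mem_powerset]
    refine ⟨hc, fun u hu => ?_⟩
    simpa using G.edge_vert (hadj u hu).symm
  · intro G hG hdeg e
    induction e using Sym2.ind with
    | _ a b =>
      set T : V → V → Finset (V × Finset V) := fun a b =>
        ((GraphOn.finite_neighborSet hG a).toFinset.powersetCard (k - 1)).image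
          fun A => (a, insert b A) with hT
      have hTcard : ∀ a b, (T a b).card ≤ d ^ (k - 1) := by
        intro a b
        refine Finset.card_image_le.trans ?_
        rw [Finset.card_powersetCard,
          ← Set.ncard_eq_toFinset_card _ (GraphOn.finite_neighborSet hG a)]
        exact (Nat.choose_le_pow _ _).trans (Nat.pow_le_pow_left (hdeg a) _)
      have hmem : ∀ c A b, A.card = k → (∀ u ∈ A, G.Adj c u) → b ∈ A → (c, A) ∈ T c b := by
        intro c A b hA hadj hb
        refine Finset.mem_image.mpr ⟨A.erase b, Finset.mem_powersetCard.mpr ⟨?_, ?_⟩, ?_⟩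
        · intro u hu
          simpa using hadj u (Finset.mem_of_mem_erase hu)
        · rw [Finset.card_erase_of_mem hb, hA]
        · rw [Finset.insert_erase hb]
      calc _ ≤ (↑(T a b ∪ T b a) : Set (V × Finset V)).ncard := by
            refine Set.ncard_le_ncard ?_ (Finset.finite_toSet _)
            rintro ⟨c, A⟩ ⟨⟨-, hA, hadj⟩, u, hu, he⟩
            simp only [Finset.coe_union, Set.mem_union, Finset.mem_coe]
            rcases Sym2.eq_iff.mp he with ⟨rfl, rfl⟩ | ⟨rfl, rfl⟩
            · exact Or.inl (hmem _ _ _ hA hadj hu)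
            · exact Or.inr (hmem _ _ _ hA hadj hu)
        _ ≤ 2 * d ^ (k - 1) := by
            rw [Set.ncard_coe_finset, two_mul]
            exact (Finset.card_union_le _ _).trans (add_le_add (hTcard a b) (hTcard b a))

lemma AgreeOff.mem_verts_iff (h : AgreeOff N d x B P P') {v : V} (hv : v ≠ x) (n : ℕ) :
    v ∈ (P n).verts ↔ v ∈ (P' n).verts := by
  simp [h.verts_eq, hv]

lemma AgreeOff.incident_mem (h : AgreeOff N d x B P P') {n : ℕ} (hn : n ≤ N) {e : Sym2 V}
    (he : e ∈ (P n).edgeSet) (hx : x ∈ e) : e ∈ B := by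
  by_contra heB
  have he' := (h.edges_iff n hn e heB).mp he
  have := SimpleGraph.Subgraph.mem_verts_of_mem_edge he' hx
  rw [h.verts_eq] at this
  exact this.2 rfl

lemma GraphOn.deg_mono {G H : GraphOn V} (hGH : G ≤ H) (hH : H.verts.Finite) (v : V) :
    GraphOn.deg G v ≤ GraphOn.deg H v :=
  Set.ncard_le_ncard (fun _ hw => hGH.2 hw) (GraphOn.finite_neighborSet hH v)

lemma GraphOn.degreeHist_eq {D : ℕ} {G : GraphOn V} (hG : G.verts.Finite) (i : Fin (D + 1)) :
    GraphOn.degreeHist D G i = ({v | v ∈ G.verts ∧ (i : ℕ) ≤ GraphOn.deg G v}.ncard : ℝ) -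
      ({v | v ∈ G.verts ∧ (i : ℕ) + 1 ≤ GraphOn.deg G v}.ncard : ℝ) := by
  have hfin : {v | v ∈ G.verts ∧ (i : ℕ) ≤ GraphOn.deg G v}.Finite := hG.subset fun _ hv => hv.1
  have hsub : {v | v ∈ G.verts ∧ (i : ℕ) + 1 ≤ GraphOn.deg G v} ⊆
      {v | v ∈ G.verts ∧ (i : ℕ) ≤ GraphOn.deg G v} := fun v hv => ⟨hv.1, (Nat.le_succ _).trans hv.2⟩
  have hset : {v | v ∈ G.verts ∧ GraphOn.deg G v = (i : ℕ)} =
      {v | v ∈ G.verts ∧ (i : ℕ) ≤ GraphOn.deg G v} \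
        {v | v ∈ G.verts ∧ (i : ℕ) + 1 ≤ GraphOn.deg G v} := by
    ext v
    simp only [Set.mem_ofPred_eq, Set.mem_sdiff]
    grind
  rw [GraphOn.degreeHist, hset, eq_sub_iff_add_eq, ← Nat.cast_add,
    Set.ncard_sdiff_add_ncard_of_subset hsub hfin]

lemma AgreeOff.seqVariation_degreeHist_le (h : AgreeOff N d x B P P') {D : ℕ}
    (i : Fin (D + 1)) :
    seqVariation N (fun n => GraphOn.degreeHist D (P n) i - GraphOn.degreeHist D (P' n) i) ≤
      4 * (2 * B.card + 1) := by
  classical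
  set Y : Finset V := insert x (B.biUnion fun e => e.toFinset) with hY
  have hYcard : Y.card ≤ 2 * B.card + 1 := by
    refine (Finset.card_insert_le _ _).trans (Nat.add_le_add_right ?_ 1)
    rw [mul_comm]
    refine Finset.card_biUnion_le_card_mul _ _ _ fun e _ => ?_
    by_cases he : e.IsDiag
    · rw [Sym2.card_toFinset_of_isDiag e he]
      norm_num
    · rw [Sym2.card_toFinset_of_not_isDiag e he]
  have hagree : ∀ n ≤ N, ∀ v ∉ Y, (v ∈ (P n).verts ↔ v ∈ (P' n).verts) ∧
      GraphOn.deg (P n) v = GraphOn.deg (P' n) v := by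
    intro n hn v hv
    simp only [hY, Finset.mem_insert, Finset.mem_biUnion, Sym2.mem_toFinset, not_or, not_exists,
      not_and] at hv
    refine ⟨h.mem_verts_iff hv.1 n, ?_⟩
    unfold GraphOn.deg
    congr 1
    ext w
    exact h.edges_iff n hn s(v, w) fun hB => hv.2 _ hB (Sym2.mem_mk_left v w)
  have hmono : ∀ (Q : ℕ → GraphOn V), Monotone Q → (∀ n, (Q n).verts.Finite) → ∀ j : ℕ,
      Monotone fun n => {v | v ∈ (Q n).verts ∧ j ≤ GraphOn.deg (Q n) v} :=
    fun Q hQ hf j a b hab v hv =>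
      ⟨(hQ hab).1 hv.1, hv.2.trans (GraphOn.deg_mono (hQ hab) (hf b) v)⟩
  have key : ∀ j : ℕ, seqVariation N (fun n =>
      ({v | v ∈ (P n).verts ∧ j ≤ GraphOn.deg (P n) v}.ncard : ℝ) -
        ({v | v ∈ (P' n).verts ∧ j ≤ GraphOn.deg (P' n) v}.ncard : ℝ)) ≤
      2 * (2 * B.card + 1) := by
    intro j
    refine (seqVariation_ncard_sub_le (hmono P h.mono h.finite j) (hmono P' h.mono' h.finite' j)
      (fun n => (h.finite n).subset fun _ hv => hv.1)
      (fun n => (h.finite' n).subset fun _ hv => hv.1) Y.finite_toSet ?_).trans ?_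
    · intro n hn v hv
      obtain ⟨h1, h2⟩ := hagree n hn v hv
      simp only [Set.mem_ofPred_eq, h1, h2]
    · rw [Set.ncard_coe_finset]
      have : (Y.card : ℝ) ≤ 2 * B.card + 1 := by exact_mod_cast hYcard
      linarith
  have := (seqVariation_sub_le N _ _).trans (add_le_add (key i) (key ((i : ℕ) + 1)))
  refine (le_of_eq (seqVariation_congr fun n _ => ?_)).trans (this.trans (le_of_eq (by ring)))
  rw [GraphOn.degreeHist_eq (h.finite n), GraphOn.degreeHist_eq (h.finite' n)]
  ring

end GraphFamilies

end

noncomputable section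

section Components

variable {V : Type u}

/-- The number of connected components of `H` that meet `W`. -/
def numComponentsMeeting (H : SimpleGraph V) (W : Set V) : ℕ :=
  (H.connectedComponentMk '' W).ncard

lemma reachable_sup_edge {H : SimpleGraph V} {a b u v : V}
    (h : (H ⊔ SimpleGraph.edge a b).Reachable u v) :
    H.Reachable u v ∨ (H.Reachable u a ∧ H.Reachable b v) ∨
      (H.Reachable u b ∧ H.Reachable a v) := by
  rw [SimpleGraph.reachable_iff_reflTransGen] at h
  induction h with
  | refl => exact Or.inl (SimpleGraph.Reachable.refl _)
  | @tail v w _ hvw ih =>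
    rw [SimpleGraph.sup_adj, SimpleGraph.edge_adj] at hvw
    rcases hvw with hvw | ⟨⟨rfl, rfl⟩ | ⟨rfl, rfl⟩, -⟩
    · rcases ih with h1 | ⟨h1, h2⟩ | ⟨h1, h2⟩
      · exact Or.inl (h1.trans hvw.reachable)
      · exact Or.inr (Or.inl ⟨h1, h2.trans hvw.reachable⟩)
      · exact Or.inr (Or.inr ⟨h1, h2.trans hvw.reachable⟩)
    · rcases ih with h1 | ⟨h1, h2⟩ | ⟨h1, h2⟩
      · exact Or.inr (Or.inl ⟨h1, SimpleGraph.Reachable.refl _⟩)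
      · exact Or.inr (Or.inl ⟨h1, SimpleGraph.Reachable.refl _⟩)
      · exact Or.inl h1
    · rcases ih with h1 | ⟨h1, h2⟩ | ⟨h1, h2⟩
      · exact Or.inr (Or.inr ⟨h1, SimpleGraph.Reachable.refl _⟩)
      · exact Or.inl h1
      · exact Or.inr (Or.inr ⟨h1, SimpleGraph.Reachable.refl _⟩)

lemma image_map_ofLE {H H' : SimpleGraph V} (hle : H ≤ H') (W : Set V) :
    SimpleGraph.ConnectedComponent.map (SimpleGraph.Hom.ofLE hle) ''
      (H.connectedComponentMk '' W) = H'.connectedComponentMk '' W := by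
  rw [Set.image_image]
  rfl

open Classical in
lemma numComponentsMeeting_sup_edge (H : SimpleGraph V) {W : Set V} (hW : W.Finite) {a b : V}
    (ha : a ∈ W) (hb : b ∈ W) :
    numComponentsMeeting H W =
      numComponentsMeeting (H ⊔ SimpleGraph.edge a b) W + if H.Reachable a b then 0 else 1 := by
  have hle : H ≤ H ⊔ SimpleGraph.edge a b := le_sup_left
  unfold numComponentsMeeting
  rw [← image_map_ofLE hle]
  split_ifs with hab
  · rw [add_zero]
    refine (Set.ncard_image_of_injective _ ?_).symm
    intro C C'
    induction C using SimpleGraph.ConnectedComponent.ind with | _ u =>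
    induction C' using SimpleGraph.ConnectedComponent.ind with | _ v =>
    intro huv
    have huv : (H ⊔ SimpleGraph.edge a b).Reachable u v :=
      SimpleGraph.ConnectedComponent.exact huv
    refine SimpleGraph.ConnectedComponent.sound ?_
    rcases reachable_sup_edge huv with h | ⟨h1, h2⟩ | ⟨h1, h2⟩
    · exact h
    · exact h1.trans (hab.trans h2)
    · exact h1.trans (hab.symm.trans h2)
  · set m := SimpleGraph.ConnectedComponent.map (SimpleGraph.Hom.ofLE hle) with hm
    set I := H.connectedComponentMk '' W with hI
    have hbI : H.connectedComponentMk b ∈ I := ⟨b, hb, rfl⟩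
    have hm_eq : m '' I = m '' (I \ {H.connectedComponentMk b}) := by
      refine Set.Subset.antisymm ?_ (Set.image_mono Set.sdiff_subset)
      rintro _ ⟨C, hC, rfl⟩
      by_cases hCb : C = H.connectedComponentMk b
      · refine ⟨H.connectedComponentMk a, ⟨⟨a, ha, rfl⟩, fun h => hab ?_⟩, ?_⟩
        · exact SimpleGraph.ConnectedComponent.exact h
        · rw [hCb]
          refine SimpleGraph.ConnectedComponent.sound
            (SimpleGraph.Adj.reachable ?_)
          refine Or.inr ((SimpleGraph.edge_adj ..).mpr ⟨Or.inl ⟨rfl, rfl⟩, ?_⟩)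
          intro h
          have h : a = b := h
          exact hab (h ▸ SimpleGraph.Reachable.refl _)
      · exact ⟨C, ⟨hC, hCb⟩, rfl⟩
    suffices hinj : Set.InjOn m (I \ {H.connectedComponentMk b}) by
      rw [hm_eq, hinj.ncard_image, Set.ncard_sdiff_singleton_add_one hbI (hW.image _)]
    rintro C ⟨-, hC⟩ C' ⟨-, hC'⟩
    revert hC hC'
    induction C using SimpleGraph.ConnectedComponent.ind with | _ u =>
    induction C' using SimpleGraph.ConnectedComponent.ind with | _ v =>
    intro hu hv huv
    have huv : (H ⊔ SimpleGraph.edge a b).Reachable u v :=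
      SimpleGraph.ConnectedComponent.exact huv
    refine SimpleGraph.ConnectedComponent.sound ?_
    rcases reachable_sup_edge huv with h | ⟨h1, h2⟩ | ⟨h1, h2⟩
    · exact h
    · exact absurd (SimpleGraph.ConnectedComponent.sound h2.symm) hv
    · exact absurd (SimpleGraph.ConnectedComponent.sound h1) hu

open Classical in
lemma numComponentsMeeting_sdiff_singleton {H : SimpleGraph V} {W : Set V} (hW : W.Finite) {x : V}
    (hx : ∀ v, ¬ H.Adj x v) :
    numComponentsMeeting H W =
      numComponentsMeeting H (W \ {x}) + if x ∈ W then 1 else 0 := by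
  split_ifs with hxW
  · unfold numComponentsMeeting
    have hnot : H.connectedComponentMk x ∉ H.connectedComponentMk '' (W \ {x}) := by
      rintro ⟨v, ⟨-, hv⟩, hvx⟩
      have h := SimpleGraph.ConnectedComponent.exact hvx
      rw [SimpleGraph.reachable_comm, SimpleGraph.reachable_iff_reflTransGen] at h
      rcases Relation.ReflTransGen.cases_head h with h1 | ⟨w, h1, -⟩
      · exact hv h1.symm
      · exact hx w h1
    rw [← Set.ncard_insert_of_notMem hnot ((hW.subset Set.sdiff_subset).image _),
      ← Set.image_insert_eq, Set.insert_sdiff_singleton, Set.insert_eq_of_mem hxW]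
  · rw [Set.sdiff_singleton_eq_self hxW, add_zero]

lemma GraphOn.reachable_coe_iff {G : GraphOn V} (a b : G.verts) :
    G.coe.Reachable a b ↔ G.spanningCoe.Reachable a b := by
  constructor
  · intro h
    exact h.map (⟨fun v => v.1, fun hab => hab⟩ : G.coe →g G.spanningCoe)
  · intro h
    obtain ⟨b, hb⟩ := b
    change G.spanningCoe.Reachable a b at h
    rw [SimpleGraph.reachable_iff_reflTransGen] at h
    revert hb
    induction h with
    | refl => exact fun _ => SimpleGraph.Reachable.refl _
    | @tail v w _ hvw ih =>
      intro hw
      have hvw : G.Adj v w := hvw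
      refine (ih (G.edge_vert hvw)).trans (SimpleGraph.Adj.reachable ?_)
      exact hvw

lemma GraphOn.numComponents_eq (G : GraphOn V) :
    GraphOn.numComponents G = numComponentsMeeting G.spanningCoe G.verts := by
  unfold GraphOn.numComponents numComponentsMeeting
  rw [← Nat.card_coe_set_eq]
  congr 1
  refine Nat.card_congr (Equiv.ofBijective
    (SimpleGraph.ConnectedComponent.lift
      (fun v => ⟨G.spanningCoe.connectedComponentMk v, ⟨v, v.2, rfl⟩⟩) ?_) ⟨?_, ?_⟩)
  · intro v w p _
    exact Subtype.ext (SimpleGraph.ConnectedComponent.sound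
      ((GraphOn.reachable_coe_iff v w).mp p.reachable))
  · intro C C'
    induction C using SimpleGraph.ConnectedComponent.ind with | _ u =>
    induction C' using SimpleGraph.ConnectedComponent.ind with | _ v =>
    intro huv
    exact SimpleGraph.ConnectedComponent.sound ((GraphOn.reachable_coe_iff u v).mpr
      (SimpleGraph.ConnectedComponent.exact (Subtype.ext_iff.mp huv)))
  · rintro ⟨_, v, hv, rfl⟩
    exact ⟨G.coe.connectedComponentMk ⟨v, hv⟩, rfl⟩

lemma seqVariation_indicator_le (N : ℕ) {p : ℕ → Prop} [DecidablePred p] (hp : ∀ n, p n → p (n + 1)) :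
    seqVariation N (fun n => if p n then (1 : ℝ) else 0) ≤ 1 := by
  rw [seqVariation_of_monotone]
  · split_ifs <;> norm_num
  · intro n _
    by_cases h : p n
    · rw [if_pos h, if_pos (hp n h)]
    · rw [if_neg h]
      split_ifs <;> norm_num

lemma seqVariation_deleteEdges_le {P : ℕ → GraphOn V} (hP : Monotone P)
    (hfin : ∀ n, (P n).verts.Finite) (N : ℕ) (B : Finset (Sym2 V)) :
    seqVariation N (fun n => (numComponentsMeeting (P n).spanningCoe (P n).verts : ℝ) -
      numComponentsMeeting ((P n).spanningCoe.deleteEdges B) (P n).verts) ≤ 2 * B.card := by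
  classical
  induction B using Finset.induction with
  | empty => simp [seqVariation]
  | insert e B heB ih =>
    refine (seqVariation_sub_le_add N _
      (fun n => (numComponentsMeeting ((P n).spanningCoe.deleteEdges B) (P n).verts : ℝ)) _).trans
      ?_
    rw [Finset.card_insert_of_notMem heB]
    push_cast
    suffices hsuff : seqVariation N (fun n =>
        (numComponentsMeeting ((P n).spanningCoe.deleteEdges B) (P n).verts : ℝ) -
          numComponentsMeeting ((P n).spanningCoe.deleteEdges (insert e B : Finset _))
            (P n).verts) ≤ 2 by
      push_cast at hsuff
      linarith
    induction e using Sym2.ind with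
    | _ a b =>
      set H : ℕ → SimpleGraph V := fun n =>
        (P n).spanningCoe.deleteEdges (insert s(a, b) B : Finset (Sym2 V)) with hH
      have hHmono : ∀ n, H n ≤ H (n + 1) := fun n u v huv => by
        simp only [hH, SimpleGraph.deleteEdges_adj] at huv ⊢
        exact ⟨(hP n.le_succ).2 huv.1, huv.2⟩
      have hval : ∀ n,
          (numComponentsMeeting ((P n).spanningCoe.deleteEdges B) (P n).verts : ℝ) -
            numComponentsMeeting (H n) (P n).verts =
          (if (P n).Adj a b ∧ (H n).Reachable a b then (1 : ℝ) else 0) -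
            (if (P n).Adj a b then (1 : ℝ) else 0) := by
        intro n
        by_cases hab : (P n).Adj a b
        · have heq : (P n).spanningCoe.deleteEdges B = H n ⊔ SimpleGraph.edge a b := by
            ext u v
            simp only [hH, SimpleGraph.sup_adj, SimpleGraph.deleteEdges_adj, SimpleGraph.edge_adj,
              Finset.coe_insert, Set.mem_insert_iff, not_or, SimpleGraph.Subgraph.spanningCoe_adj,
              Finset.mem_coe]
            constructor
            · rintro ⟨h1, h2⟩
              by_cases h3 : s(u, v) = s(a, b)
              · exact Or.inr ⟨Sym2.eq_iff.mp h3, h1.ne⟩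
              · exact Or.inl ⟨h1, h3, h2⟩
            · rintro (⟨h1, -, h2⟩ | ⟨h1, -⟩)
              · exact ⟨h1, h2⟩
              · have h3 : s(u, v) = s(a, b) := Sym2.eq_iff.mpr h1
                rw [h3]
                refine ⟨?_, heB⟩
                rw [← SimpleGraph.Subgraph.mem_edgeSet, h3]
                exact hab
          rw [heq, numComponentsMeeting_sup_edge (H n) (hfin n) ((P n).edge_vert hab)
            ((P n).edge_vert hab.symm)]
          by_cases hr : (H n).Reachable a b <;> simp [hab, hr]
        · have heq : (P n).spanningCoe.deleteEdges B = H n := by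
            ext u v
            simp only [hH, SimpleGraph.deleteEdges_adj, Finset.coe_insert, Set.mem_insert_iff,
              not_or, SimpleGraph.Subgraph.spanningCoe_adj, Finset.mem_coe]
            refine and_congr_right fun huv => ⟨fun h => ⟨fun h3 => hab ?_, h⟩, fun h => h.2⟩
            rw [← SimpleGraph.Subgraph.mem_edgeSet, ← h3]
            exact huv
          rw [heq]
          simp [hab]
      rw [seqVariation_congr fun n _ => hval n]
      refine (seqVariation_sub_le N _ _).trans ?_
      have h1 := seqVariation_indicator_le N
        (p := fun n => (P n).Adj a b ∧ (H n).Reachable a b)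
        fun n hn => ⟨(hP n.le_succ).2 hn.1, hn.2.mono (hHmono n)⟩
      have h2 := seqVariation_indicator_le N (p := fun n => (P n).Adj a b)
        fun n hn => (hP n.le_succ).2 hn
      linarith

lemma AgreeOff.seqVariation_numComponents_le {N d : ℕ} {x : V} {B : Finset (Sym2 V)}
    {P P' : ℕ → GraphOn V} (h : AgreeOff N d x B P P') :
    seqVariation N (fun n => GraphOn.numComponents (P n) - GraphOn.numComponents (P' n)) ≤
      4 * B.card + 1 := by
  classical
  simp_rw [GraphOn.numComponents_eq]
  set f : ℕ → ℝ := fun n =>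
    numComponentsMeeting ((P n).spanningCoe.deleteEdges B) (P n).verts with hf
  set f' : ℕ → ℝ := fun n =>
    numComponentsMeeting ((P' n).spanningCoe.deleteEdges B) (P' n).verts with hf'
  have h1 := seqVariation_deleteEdges_le h.mono h.finite N B
  have h2 := seqVariation_deleteEdges_le h.mono' h.finite' N B
  rw [seqVariation_sub_comm] at h2
  have h3 : seqVariation N (fun n => f n - f' n) ≤ 1 := by
    rw [seqVariation_congr (g := fun n => if x ∈ (P n).verts then (1 : ℝ) else 0)]
    · exact seqVariation_indicator_le N fun n hn => (h.mono n.le_succ).1 hn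
    · intro n hn
      have hgraph : (P' n).spanningCoe.deleteEdges B = (P n).spanningCoe.deleteEdges B := by
        ext u v
        simp only [SimpleGraph.deleteEdges_adj, SimpleGraph.Subgraph.spanningCoe_adj]
        exact and_congr_left fun hB => (h.edges_iff n hn s(u, v) hB).symm
      have hiso : ∀ v, ¬ ((P n).spanningCoe.deleteEdges B).Adj x v := by
        intro v hv
        rw [SimpleGraph.deleteEdges_adj] at hv
        exact hv.2 (h.incident_mem hn (e := s(x, v)) hv.1 (Sym2.mem_mk_left x v))
      simp only [hf, hf', hgraph, h.verts_eq]
      rw [numComponentsMeeting_sdiff_singleton (h.finite n) hiso]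
      push_cast
      ring
  refine (seqVariation_sub_le_add N _ f _).trans ?_
  have h4 := seqVariation_sub_le_add N f f'
    (fun n => (numComponentsMeeting (P' n).spanningCoe (P' n).verts : ℝ))
  linarith

end Components

end

noncomputable section

lemma GraphOn.deg_eq_ncard_incident {V : Type u} (G : GraphOn V) (v : V) :
    GraphOn.deg G v = {e ∈ G.edgeSet | v ∈ e}.ncard := by
  have h : {e ∈ G.edgeSet | v ∈ e} = (fun w => s(v, w)) '' G.neighborSet v := by
    ext e
    constructor
    · rintro ⟨he, hv⟩
      obtain ⟨w, rfl⟩ := Sym2.mem_iff_exists.mp hv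
      exact ⟨w, he, rfl⟩
    · rintro ⟨w, hw, rfl⟩
      exact ⟨hw, Sym2.mem_mk_left v w⟩
  rw [h, Set.ncard_image_of_injective _ fun a b hab => Sym2.congr_right.mp hab, GraphOn.deg]

namespace GraphStream

open Classical

variable {V : Type u} {T : ℕ}

/-- The nodes that arrive in the first `n` steps. -/
def nodesBefore (S : GraphStream V T) (n : ℕ) : Finset V :=
  (Finset.univ.filter fun s : Fin T => (s : ℕ) < n).biUnion S.nodes

/-- The edges that arrive in the first `n` steps. -/
def edgesBefore (S : GraphStream V T) (n : ℕ) : Finset (Sym2 V) :=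
  (Finset.univ.filter fun s : Fin T => (s : ℕ) < n).biUnion S.edges

/-- The number of edges at `v` that arrive in the first `n` steps. -/
def degBefore (S : GraphStream V T) (n : ℕ) (v : V) : ℕ :=
  ((S.edgesBefore n).filter fun e => v ∈ e).card

/-- The number of steps after which an edge has arrived. -/
def arrival (S : GraphStream V T) (e : Sym2 V) : ℕ := sInf {n | e ∈ S.edgesBefore n}

/-- The order of the edges by arrival, with ties broken by a fixed well-order. -/
def Precedes (S : GraphStream V T) (e' e : Sym2 V) : Prop :=
  Prod.Lex (· < ·) WellOrderingRel (S.arrival e', e') (S.arrival e, e)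

/-- The number of edges at `v` that precede `e`. -/
def rank (S : GraphStream V T) (v : V) (e : Sym2 V) : ℕ :=
  ((S.edgesBefore T).filter fun e' => v ∈ e' ∧ S.Precedes e' e).card

/-- The edges among those of the first `n` steps that are among the first `c` edges of both of
their endpoints. -/
def keptBefore (S : GraphStream V T) (c n : ℕ) : Finset (Sym2 V) :=
  (S.edgesBefore n).filter fun e => ∀ v ∈ e, S.rank v e < c

/-- The least `k` such that at most `k` nodes of the first `n` steps have degree above `D + k`. -/
def excess (S : GraphStream V T) (D n : ℕ) : ℕ :=
  sInf {k | ((S.nodesBefore n).filter fun v => D + k < S.degBefore n v).card ≤ k}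

section Basic

variable (S : GraphStream V T)

variable {S} in
lemma mem_nodesBefore {n : ℕ} {v : V} :
    v ∈ S.nodesBefore n ↔ ∃ s : Fin T, (s : ℕ) < n ∧ v ∈ S.nodes s := by
  simp [nodesBefore]

variable {S} in
lemma mem_edgesBefore {n : ℕ} {e : Sym2 V} :
    e ∈ S.edgesBefore n ↔ ∃ s : Fin T, (s : ℕ) < n ∧ e ∈ S.edges s := by
  simp [edgesBefore]

lemma nodesBefore_mono : Monotone S.nodesBefore := fun a b hab v hv => by
  obtain ⟨s, hs, hv⟩ := mem_nodesBefore.mp hv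
  exact mem_nodesBefore.mpr ⟨s, hs.trans_le hab, hv⟩

lemma edgesBefore_mono : Monotone S.edgesBefore := fun a b hab v hv => by
  obtain ⟨s, hs, hv⟩ := mem_edgesBefore.mp hv
  exact mem_edgesBefore.mpr ⟨s, hs.trans_le hab, hv⟩

variable {S} in
lemma mem_edgesBefore_horizon {n : ℕ} {e : Sym2 V} (he : e ∈ S.edgesBefore n) :
    e ∈ S.edgesBefore T := by
  obtain ⟨s, -, hs⟩ := mem_edgesBefore.mp he
  exact mem_edgesBefore.mpr ⟨s, s.2, hs⟩

variable {S} in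
lemma arrival_le {n : ℕ} {e : Sym2 V} (he : e ∈ S.edgesBefore n) : S.arrival e ≤ n :=
  Nat.sInf_le he

variable {S} in
lemma mem_edgesBefore_arrival {n : ℕ} {e : Sym2 V} (he : e ∈ S.edgesBefore n) :
    e ∈ S.edgesBefore (S.arrival e) :=
  Nat.sInf_mem (s := {n | e ∈ S.edgesBefore n}) ⟨n, he⟩

variable {S} in
lemma Precedes.arrival_le {e' e : Sym2 V} (h : S.Precedes e' e) : S.arrival e' ≤ S.arrival e := by
  rcases (Prod.lex_def).mp h with h | h
  · exact h.le
  · exact h.1.le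

lemma precedes_irrefl (e : Sym2 V) : ¬ S.Precedes e e := irrefl_of (Prod.Lex _ _) _

variable {S} in
lemma Precedes.trans {e₁ e₂ e₃ : Sym2 V} (h : S.Precedes e₁ e₂) (h' : S.Precedes e₂ e₃) :
    S.Precedes e₁ e₃ := trans_of (Prod.Lex _ _) h h'

lemma precedes_trichotomous (e e' : Sym2 V) : S.Precedes e e' ∨ e = e' ∨ S.Precedes e' e := by
  rcases trichotomous_of (Prod.Lex (· < ·) WellOrderingRel)
    (S.arrival e, e) (S.arrival e', e') with h | h | h
  · exact Or.inl h
  · exact Or.inr (Or.inl (Prod.mk.inj h).2)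
  · exact Or.inr (Or.inr h)

lemma Precedes.mem_edgesBefore {n : ℕ} {e' e : Sym2 V} (h : S.Precedes e' e)
    (he' : e' ∈ S.edgesBefore T) (he : e ∈ S.edgesBefore n) : e' ∈ S.edgesBefore n :=
  S.edgesBefore_mono (h.arrival_le.trans (GraphStream.arrival_le he))
    (mem_edgesBefore_arrival he')

lemma rank_lt_degBefore {n : ℕ} {e : Sym2 V} (he : e ∈ S.edgesBefore n) {v : V} (hv : v ∈ e) :
    S.rank v e < S.degBefore n v := by
  refine Finset.card_lt_card (Finset.ssubset_iff.mpr ⟨e, ?_, ?_⟩)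
  · simp [S.precedes_irrefl e]
  · intro e' he'
    rcases Finset.mem_insert.mp he' with rfl | he'
    · exact Finset.mem_filter.mpr ⟨he, hv⟩
    · obtain ⟨h1, h2, h3⟩ := Finset.mem_filter.mp he'
      exact Finset.mem_filter.mpr ⟨Precedes.mem_edgesBefore S h3 h1 he, h2⟩

lemma rank_injOn (v : V) :
    Set.InjOn (S.rank v) {e | e ∈ S.edgesBefore T ∧ v ∈ e} := by
  have aux : ∀ e ∈ S.edgesBefore T, v ∈ e → ∀ e', S.Precedes e e' → S.rank v e < S.rank v e' := by
    intro e he hv e' hee'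
    refine Finset.card_lt_card (Finset.ssubset_iff.mpr ⟨e, ?_, ?_⟩)
    · simp [S.precedes_irrefl e]
    · intro f hf
      rcases Finset.mem_insert.mp hf with rfl | hf
      · exact Finset.mem_filter.mpr ⟨he, hv, hee'⟩
      · obtain ⟨h1, h2, h3⟩ := Finset.mem_filter.mp hf
        exact Finset.mem_filter.mpr ⟨h1, h2, h3.trans hee'⟩
  rintro e ⟨he, hv⟩ e' ⟨he', hv'⟩ hee'
  rcases S.precedes_trichotomous e e' with h | h | h
  · exact absurd hee' (aux e he hv e' h).ne
  · exact h
  · exact absurd hee' (aux e' he' hv' e h).ne'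

variable {S} in
lemma mem_keptBefore {c n : ℕ} {e : Sym2 V} :
    e ∈ S.keptBefore c n ↔ e ∈ S.edgesBefore n ∧ ∀ v ∈ e, S.rank v e < c :=
  Finset.mem_filter

lemma keptBefore_mono (c : ℕ) : Monotone (S.keptBefore c) := fun _ _ hab =>
  Finset.filter_subset_filter _ (S.edgesBefore_mono hab)

lemma card_keptBefore_incident_le (c n : ℕ) (v : V) :
    ((S.keptBefore c n).filter fun e => v ∈ e).card ≤ c := by
  refine (Finset.card_le_card_of_injOn (t := Finset.range c) (S.rank v) ?_ ?_).trans_eq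
    (Finset.card_range c)
  · intro e he
    obtain ⟨h1, h2⟩ := Finset.mem_filter.mp he
    exact Finset.mem_coe.mpr (Finset.mem_range.mpr ((mem_keptBefore.mp h1).2 v h2))
  · refine (S.rank_injOn v).mono fun e he => ?_
    obtain ⟨h1, h2⟩ := Finset.mem_filter.mp he
    exact ⟨mem_edgesBefore_horizon (mem_keptBefore.mp h1).1, h2⟩

/-- The graph of the edges of the first `n` steps that are among the first `c` edges of both of
their endpoints. -/
def projected (c n : ℕ) : GraphOn V where
  verts := S.nodesBefore n
  Adj u v := s(u, v) ∈ S.keptBefore c n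
  adj_sub := by
    intro u v h
    obtain ⟨s, -, hs⟩ := mem_edgesBefore.mp (mem_keptBefore.mp h).1
    rw [SimpleGraph.top_adj]
    intro huv
    exact S.edge_not_loop s _ hs (by simpa using huv)
  edge_vert := by
    intro u v h
    obtain ⟨s, hsn, hs⟩ := mem_edgesBefore.mp (mem_keptBefore.mp h).1
    obtain ⟨r, hr, hu⟩ := S.endpoint_arrived s _ hs u (by simp)
    exact mem_nodesBefore.mpr ⟨r, (Fin.le_def.mp hr).trans_lt hsn, hu⟩
  symm := ⟨by
    intro u v h
    rwa [Sym2.eq_swap]⟩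

variable {S} in
lemma mem_edgeSet_projected {c n : ℕ} {e : Sym2 V} :
    e ∈ (S.projected c n).edgeSet ↔ e ∈ S.keptBefore c n := by
  induction e using Sym2.ind with | _ u v => rfl

lemma projected_mono (c : ℕ) : Monotone (S.projected c) := fun _ _ hab =>
  ⟨fun _ hv => S.nodesBefore_mono hab hv, fun _ _ h => S.keptBefore_mono c hab h⟩

lemma projected_finite (c n : ℕ) : (S.projected c n).verts.Finite :=
  Finset.finite_toSet _

lemma deg_projected_le (c n : ℕ) (v : V) : GraphOn.deg (S.projected c n) v ≤ c := by
  refine le_trans (le_of_eq ?_) (S.card_keptBefore_incident_le c n v)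
  rw [GraphOn.deg_eq_ncard_incident, ← Set.ncard_coe_finset]
  congr 1
  ext e
  simp [mem_edgeSet_projected]

lemma projected_zero (c : ℕ) : S.projected c 0 = ⊥ := by
  refine SimpleGraph.Subgraph.ext ?_ ?_
  · simp [projected, nodesBefore]
  · ext u v
    simp [projected, keptBefore, edgesBefore]

lemma mem_verts_flatten (t : Fin T) (v : V) :
    v ∈ (S.flatten t).verts ↔ v ∈ S.nodesBefore (t + 1) := by
  simp only [mem_nodesBefore, Nat.lt_succ_iff, ← Fin.le_def]
  rfl

lemma mem_edgeSet_flatten (t : Fin T) (e : Sym2 V) :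
    e ∈ (S.flatten t).edgeSet ↔ e ∈ S.edgesBefore (t + 1) := by
  simp only [mem_edgesBefore, Nat.lt_succ_iff, ← Fin.le_def]
  induction e using Sym2.ind with | _ u v => rfl

lemma deg_flatten (t : Fin T) (v : V) : GraphOn.deg (S.flatten t) v = S.degBefore (t + 1) v := by
  rw [GraphOn.deg_eq_ncard_incident, degBefore, ← Set.ncard_coe_finset]
  congr 1
  ext e
  simp [mem_edgeSet_flatten]

lemma degBefore_mono (v : V) : Monotone fun n => S.degBefore n v := fun _ _ hab =>
  Finset.card_le_card (Finset.filter_subset_filter _ (S.edgesBefore_mono hab))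

lemma degBefore_le_of_maxDegreeLE {t : Fin T} {D : ℕ} (h : (S.flatten t).MaxDegreeLE D) (v : V) :
    S.degBefore (t + 1) v ≤ D := by
  by_cases hv : v ∈ (S.flatten t).verts
  · rw [← deg_flatten]
    exact h v hv
  · rw [degBefore, Finset.card_eq_zero.mpr]
    · exact Nat.zero_le _
    · refine Finset.filter_eq_empty_iff.mpr fun e he hve => hv ?_
      exact SimpleGraph.Subgraph.mem_verts_of_mem_edge ((S.mem_edgeSet_flatten t e).mpr he) hve

lemma projected_eq_flatten {t : Fin T} {D c : ℕ} (hDc : D ≤ c)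
    (h : (S.flatten t).MaxDegreeLE D) : S.projected c (t + 1) = S.flatten t := by
  refine SimpleGraph.Subgraph.ext ?_ ?_
  · ext v
    exact (S.mem_verts_flatten t v).symm
  · ext u v
    change s(u, v) ∈ S.keptBefore c (t + 1) ↔ s(u, v) ∈ (S.flatten t).edgeSet
    rw [mem_edgeSet_flatten, mem_keptBefore]
    exact and_iff_left_of_imp fun he w hw =>
      (S.rank_lt_degBefore he hw).trans_le ((S.degBefore_le_of_maxDegreeLE h w).trans hDc)

variable {S} in
lemma excess_le {D n k : ℕ}
    (h : ((S.nodesBefore n).filter fun v => D + k < S.degBefore n v).card ≤ k) :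
    S.excess D n ≤ k := Nat.sInf_le h

variable {S} in
lemma card_filter_degBefore_le {D n k : ℕ} (h : S.excess D n ≤ k) :
    ((S.nodesBefore n).filter fun v => D + k < S.degBefore n v).card ≤ k := by
  have hmem : ((S.nodesBefore n).filter fun v => D + S.excess D n < S.degBefore n v).card ≤
      S.excess D n := by
    refine Nat.sInf_mem
      (s := {k | ((S.nodesBefore n).filter fun v => D + k < S.degBefore n v).card ≤ k}) ?_
    exact ⟨(S.nodesBefore n).card, Finset.card_filter_le _ _⟩
  refine le_trans (Finset.card_le_card fun v hv => ?_) (hmem.trans h)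
  obtain ⟨h1, h2⟩ := Finset.mem_filter.mp hv
  exact Finset.mem_filter.mpr ⟨h1, by omega⟩

@[simp] lemma excess_zero (D : ℕ) : S.excess D 0 = 0 :=
  Nat.le_zero.mp (excess_le (by simp [nodesBefore]))

lemma excess_eq_zero {D n : ℕ} (h : ∀ v, S.degBefore n v ≤ D) : S.excess D n = 0 := by
  refine Nat.le_zero.mp (excess_le (le_of_eq ?_))
  refine Finset.card_eq_zero.mpr (Finset.filter_eq_empty_iff.mpr fun v _ => ?_)
  have := h v
  omega

end Basic

end GraphStream

end

noncomputable section

namespace GraphStream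

open Classical

variable {V : Type u} {T : ℕ}

/-- The streams agree in the first `n` steps. -/
def AgreeBefore (S S' : GraphStream V T) (n : ℕ) : Prop :=
  ∀ s : Fin T, (s : ℕ) < n → S.nodes s = S'.nodes s ∧ S.edges s = S'.edges s

namespace AgreeBefore

variable {S S' : GraphStream V T} {n : ℕ}

lemma symm (h : S.AgreeBefore S' n) : S'.AgreeBefore S n :=
  fun s hs => ⟨(h s hs).1.symm, (h s hs).2.symm⟩

lemma nodesBefore_eq (h : S.AgreeBefore S' n) {k : ℕ} (hk : k ≤ n) :
    S.nodesBefore k = S'.nodesBefore k :=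
  Finset.biUnion_congr rfl fun s hs =>
    (h s ((Finset.mem_filter.mp hs).2.trans_le hk)).1

lemma edgesBefore_eq (h : S.AgreeBefore S' n) {k : ℕ} (hk : k ≤ n) :
    S.edgesBefore k = S'.edgesBefore k :=
  Finset.biUnion_congr rfl fun s hs =>
    (h s ((Finset.mem_filter.mp hs).2.trans_le hk)).2

lemma arrival_eq (h : S.AgreeBefore S' n) {e : Sym2 V} (he : e ∈ S.edgesBefore n) :
    S.arrival e = S'.arrival e := by
  have aux : ∀ {S S' : GraphStream V T}, S.AgreeBefore S' n → e ∈ S.edgesBefore n →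
      S'.arrival e ≤ S.arrival e := by
    intro S S' h he
    refine GraphStream.arrival_le ?_
    rw [← h.edgesBefore_eq (GraphStream.arrival_le he)]
    exact mem_edgesBefore_arrival he
  refine le_antisymm (aux h.symm ?_) (aux h he)
  rwa [← h.edgesBefore_eq le_rfl]

lemma rank_eq (h : S.AgreeBefore S' n) {e : Sym2 V} (he : e ∈ S.edgesBefore n) (v : V) :
    S.rank v e = S'.rank v e := by
  have aux : ∀ {S S' : GraphStream V T}, S.AgreeBefore S' n → e ∈ S.edgesBefore n →
      S.rank v e ≤ S'.rank v e := by
    intro S S' h he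
    refine Finset.card_le_card fun f hf => ?_
    obtain ⟨h1, h2, h3⟩ := Finset.mem_filter.mp hf
    have hfn : f ∈ S.edgesBefore n := Precedes.mem_edgesBefore S h3 h1 he
    refine Finset.mem_filter.mpr ⟨?_, h2, ?_⟩
    · rw [h.edgesBefore_eq le_rfl] at hfn
      exact mem_edgesBefore_horizon hfn
    · rw [Precedes, ← h.arrival_eq he, ← h.arrival_eq hfn]
      exact h3
  refine le_antisymm (aux h he) (aux h.symm ?_)
  rwa [← h.edgesBefore_eq le_rfl]

lemma projected_eq (h : S.AgreeBefore S' n) (c : ℕ) : S.projected c n = S'.projected c n := by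
  have hkept : S.keptBefore c n = S'.keptBefore c n := by
    ext e
    rw [mem_keptBefore, mem_keptBefore, ← h.edgesBefore_eq le_rfl]
    refine and_congr_right fun he => forall₂_congr fun v _ => ?_
    rw [h.rank_eq he]
  refine SimpleGraph.Subgraph.ext ?_ ?_
  · simp only [projected, h.nodesBefore_eq le_rfl]
  · simp only [projected, hkept]

lemma excess_eq (h : S.AgreeBefore S' n) (D : ℕ) : S.excess D n = S'.excess D n := by
  have hdeg : S.degBefore n = S'.degBefore n := by
    funext v
    rw [degBefore, degBefore, h.edgesBefore_eq le_rfl]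
  rw [excess, excess, hdeg, h.nodesBefore_eq le_rfl]

end AgreeBefore

section Neighbors

/-- `S'` is obtained from `S` by removing the node `x`. -/
def RemovesAt (S S' : GraphStream V T) (x : V) : Prop :=
  (∀ t w, w ∈ S'.nodes t ↔ w ∈ S.nodes t ∧ w ≠ x) ∧
    ∀ t e, e ∈ S'.edges t ↔ e ∈ S.edges t ∧ x ∉ e

lemma RemovesNode.exists_removesAt {S S' : GraphStream V T} (h : S.RemovesNode S') :
    ∃ x, S.RemovesAt S' x := by
  obtain ⟨x, -, h1, h2⟩ := h
  exact ⟨x, h1, h2⟩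

namespace RemovesAt

variable {S S' : GraphStream V T} {x : V}

lemma mem_nodesBefore_iff (h : S.RemovesAt S' x) {n : ℕ} {v : V} :
    v ∈ S'.nodesBefore n ↔ v ∈ S.nodesBefore n ∧ v ≠ x := by
  simp only [mem_nodesBefore, h.1]
  constructor
  · rintro ⟨s, hs, hv, hx⟩
    exact ⟨⟨s, hs, hv⟩, hx⟩
  · rintro ⟨⟨s, hs, hv⟩, hx⟩
    exact ⟨s, hs, hv, hx⟩

lemma mem_edgesBefore_iff (h : S.RemovesAt S' x) {n : ℕ} {e : Sym2 V} :
    e ∈ S'.edgesBefore n ↔ e ∈ S.edgesBefore n ∧ x ∉ e := by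
  simp only [mem_edgesBefore, h.2]
  constructor
  · rintro ⟨s, hs, hv, hx⟩
    exact ⟨⟨s, hs, hv⟩, hx⟩
  · rintro ⟨⟨s, hs, hv⟩, hx⟩
    exact ⟨s, hs, hv, hx⟩

lemma card_le_of_subset_insert {v : V} (hv : v ≠ x) {A A' : Finset (Sym2 V)}
    (hA : ∀ e ∈ A, v ∈ e ∧ (x ∉ e → e ∈ A')) : A.card ≤ A'.card + 1 := by
  refine le_trans (Finset.card_le_card (t := insert s(v, x) A') fun e he => ?_)
    (Finset.card_insert_le _ _)
  by_cases hx : x ∈ e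
  · exact Finset.mem_insert.mpr (Or.inl ((Sym2.mem_and_mem_iff hv).mp ⟨(hA e he).1, hx⟩))
  · exact Finset.mem_insert_of_mem ((hA e he).2 hx)

lemma degBefore_le (h : S.RemovesAt S' x) (n : ℕ) (v : V) :
    S'.degBefore n v ≤ S.degBefore n v := by
  refine Finset.card_le_card fun e he => ?_
  obtain ⟨h1, h2⟩ := Finset.mem_filter.mp he
  exact Finset.mem_filter.mpr ⟨(h.mem_edgesBefore_iff.mp h1).1, h2⟩

lemma degBefore_le_add_one (h : S.RemovesAt S' x) (n : ℕ) {v : V} (hv : v ≠ x) :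
    S.degBefore n v ≤ S'.degBefore n v + 1 := by
  refine card_le_of_subset_insert hv fun e he => ?_
  obtain ⟨h1, h2⟩ := Finset.mem_filter.mp he
  exact ⟨h2, fun hx => Finset.mem_filter.mpr ⟨h.mem_edgesBefore_iff.mpr ⟨h1, hx⟩, h2⟩⟩

lemma arrival_eq (h : S.RemovesAt S' x) {e : Sym2 V} (he : x ∉ e) : S'.arrival e = S.arrival e := by
  unfold arrival
  congr 1
  ext n
  exact h.mem_edgesBefore_iff.trans (and_iff_left he)

lemma precedes_iff (h : S.RemovesAt S' x) {e e' : Sym2 V} (he : x ∉ e) (he' : x ∉ e') :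
    S'.Precedes e' e ↔ S.Precedes e' e := by
  rw [Precedes, Precedes, h.arrival_eq he, h.arrival_eq he']

lemma rank_le (h : S.RemovesAt S' x) {e : Sym2 V} (he : x ∉ e) (v : V) :
    S'.rank v e ≤ S.rank v e := by
  refine Finset.card_le_card fun f hf => ?_
  obtain ⟨h1, h2, h3⟩ := Finset.mem_filter.mp hf
  obtain ⟨h4, h5⟩ := h.mem_edgesBefore_iff.mp h1
  exact Finset.mem_filter.mpr ⟨h4, h2, (h.precedes_iff he h5).mp h3⟩

lemma rank_le_add_one (h : S.RemovesAt S' x) {e : Sym2 V} (he : x ∉ e) {v : V} (hv : v ≠ x) :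
    S.rank v e ≤ S'.rank v e + 1 := by
  refine card_le_of_subset_insert hv fun f hf => ?_
  obtain ⟨h1, h2, h3⟩ := Finset.mem_filter.mp hf
  exact ⟨h2, fun hx => Finset.mem_filter.mpr
    ⟨h.mem_edgesBefore_iff.mpr ⟨h1, hx⟩, h2, (h.precedes_iff he hx).mpr h3⟩⟩

lemma excess_le (h : S.RemovesAt S' x) (D n : ℕ) : S'.excess D n ≤ S.excess D n := by
  refine GraphStream.excess_le (le_trans (Finset.card_le_card fun v hv => ?_)
    (card_filter_degBefore_le (le_refl (S.excess D n))))
  obtain ⟨h1, h2⟩ := Finset.mem_filter.mp hv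
  exact Finset.mem_filter.mpr
    ⟨(h.mem_nodesBefore_iff.mp h1).1, h2.trans_le (h.degBefore_le n v)⟩

lemma excess_le_add_one (h : S.RemovesAt S' x) (D n : ℕ) :
    S.excess D n ≤ S'.excess D n + 1 := by
  refine GraphStream.excess_le (le_trans (Finset.card_le_card
    (t := insert x ((S'.nodesBefore n).filter fun v => D + S'.excess D n < S'.degBefore n v))
    fun v hv => ?_) ((Finset.card_insert_le _ _).trans
      (Nat.add_le_add_right (card_filter_degBefore_le le_rfl) 1)))
  obtain ⟨h1, h2⟩ := Finset.mem_filter.mp hv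
  by_cases hvx : v = x
  · exact Finset.mem_insert.mpr (Or.inl hvx)
  · refine Finset.mem_insert_of_mem
      (Finset.mem_filter.mpr ⟨h.mem_nodesBefore_iff.mpr ⟨h1, hvx⟩, ?_⟩)
    have := h.degBefore_le_add_one n hvx
    omega

/-- The edges that are kept in only one of the two streams. -/
lemma exists_agreeOff (h : S.RemovesAt S' x) {c m N : ℕ}
    (hm : ((S.nodesBefore N).filter fun v => c < S.degBefore N v).card ≤ m) :
    ∃ B : Finset (Sym2 V), B.card ≤ c + m ∧
      AgreeOff N c x B (S.projected c) (S'.projected c) := by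
  set B₁ := (S.keptBefore c N).filter fun e => x ∈ e with hB₁
  set B₂ := S'.keptBefore c N \ S.keptBefore c N with hB₂
  have hB₂card : B₂.card ≤ m := by
    have hex : ∀ e ∈ B₂, ∃ v ∈ e, S.rank v e = c := by
      intro e he
      obtain ⟨h1, h2⟩ := Finset.mem_sdiff.mp he
      obtain ⟨h3, h4⟩ := mem_keptBefore.mp h1
      obtain ⟨h5, h6⟩ := h.mem_edgesBefore_iff.mp h3
      have h7 : ¬ ∀ v ∈ e, S.rank v e < c := fun h7 => h2 (mem_keptBefore.mpr ⟨h5, h7⟩)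
      push Not at h7
      obtain ⟨v, hv, hvc⟩ := h7
      have h8 := h.rank_le_add_one h6 (v := v) (fun hvx => h6 (hvx ▸ hv))
      have h9 := h4 v hv
      exact ⟨v, hv, by omega⟩
    have hmem : ∀ e ∈ B₂, e ∈ S.edgesBefore N := fun e he =>
      (h.mem_edgesBefore_iff.mp (mem_keptBefore.mp (Finset.mem_sdiff.mp he).1).1).1
    have : Nonempty V := ⟨x⟩
    choose! w hw hwc using hex
    refine le_trans (Finset.card_le_card_of_injOn w ?_ ?_) hm
    · intro e he
      have hlt := S.rank_lt_degBefore (hmem e he) (hw e he)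
      rw [hwc e he] at hlt
      refine Finset.mem_coe.mpr (Finset.mem_filter.mpr ⟨?_, hlt⟩)
      obtain ⟨s, hs, hes⟩ := mem_edgesBefore.mp (hmem e he)
      obtain ⟨r, hr, hrv⟩ := S.endpoint_arrived s e hes _ (hw e he)
      exact mem_nodesBefore.mpr ⟨r, (Fin.le_def.mp hr).trans_lt hs, hrv⟩
    · intro e he e' he' hee'
      refine S.rank_injOn (w e) ⟨mem_edgesBefore_horizon (hmem e he), hw e he⟩
        ⟨mem_edgesBefore_horizon (hmem e' he'), hee' ▸ hw e' he'⟩ ?_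
      rw [hwc e he, hee', hwc e' he']
  refine ⟨B₁ ∪ B₂, (Finset.card_union_le _ _).trans
    (add_le_add (S.card_keptBefore_incident_le c N x) hB₂card), ?_⟩
  refine ⟨S.projected_mono c, S'.projected_mono c, S.projected_finite c, S'.projected_finite c,
    S.deg_projected_le c, S'.deg_projected_le c, fun n => ?_, fun n hn e he => ?_⟩
  · ext v
    exact h.mem_nodesBefore_iff
  · rw [mem_edgeSet_projected, mem_edgeSet_projected]
    constructor
    · intro hk
      have hkN := S.keptBefore_mono c hn hk
      have hx : x ∉ e := fun hx =>
        he (Finset.mem_union_left _ (Finset.mem_filter.mpr ⟨hkN, hx⟩))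
      obtain ⟨h1, h2⟩ := mem_keptBefore.mp hk
      exact mem_keptBefore.mpr ⟨h.mem_edgesBefore_iff.mpr ⟨h1, hx⟩,
        fun v hv => (h.rank_le hx v).trans_lt (h2 v hv)⟩
    · intro hk
      have hkN := S'.keptBefore_mono c hn hk
      have hkS : e ∈ S.keptBefore c N := by
        by_contra hkS
        exact he (Finset.mem_union_right _ (Finset.mem_sdiff.mpr ⟨hkN, hkS⟩))
      exact mem_keptBefore.mpr ⟨(h.mem_edgesBefore_iff.mp (mem_keptBefore.mp hk).1).1,
        (mem_keptBefore.mp hkS).2⟩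

end RemovesAt

lemma NodeNeighbor.excess_le_add_one {S S' : GraphStream V T} (h : S.NodeNeighbor S') (D n : ℕ) :
    S.excess D n ≤ S'.excess D n + 1 := by
  rcases h with h | h
  · obtain ⟨x, hx⟩ := h.exists_removesAt
    exact hx.excess_le_add_one D n
  · obtain ⟨x, hx⟩ := h.exists_removesAt
    exact (hx.excess_le D n).trans (Nat.le_succ _)

end Neighbors

end GraphStream

/-- The coordinates of `f` have total variation at most `Δ` on the difference of two families that
agree off few edges. -/
def HasSensitivity {κ : Type} [Fintype κ] (V : Type u) (f : GraphOn V → κ → ℝ) (d m : ℕ)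
    (Δ : ℝ) : Prop :=
  ∀ (N : ℕ) (x : V) (B : Finset (Sym2 V)) (P P' : ℕ → GraphOn V), AgreeOff N d x B P P' →
    B.card ≤ m → ∑ i, seqVariation N (fun n => f (P n) i - f (P' n) i) ≤ Δ

namespace GraphStream

variable {V : Type u} {T : ℕ} {κ : Type} [Fintype κ]

lemma isStable_projected {f : GraphOn V → κ → ℝ} (hf : f ⊥ = 0) {D ℓ : ℕ} {Δ : ℝ}
    (hΔ : HasSensitivity V f (D + ℓ + 1) (D + 2 * ℓ + 2) Δ) :
    IsStable (T := T) ℓ Δ (fun S n => f (S.projected (D + ℓ + 1) n))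
      (fun S n => S.excess D n) where
  value_online S S' n h := by rw [AgreeBefore.projected_eq h]
  count_online S S' n h := AgreeBefore.excess_eq h D
  count_zero S := S.excess_zero D
  value_zero S := by rw [S.projected_zero, hf]
  count_le S S' h n := h.excess_le_add_one D n
  variation_le S S' h N _ hN := by
    have key : ∀ S S' : GraphStream V T, S.RemovesNode S' → S.excess D N ≤ ℓ + 1 →
        ∑ i, seqVariation N (fun n => f (S.projected (D + ℓ + 1) n) i -
          f (S'.projected (D + ℓ + 1) n) i) ≤ Δ := by
      intro S S' h hN
      obtain ⟨x, hx⟩ := h.exists_removesAt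
      obtain ⟨B, hB, hag⟩ := hx.exists_agreeOff (card_filter_degBefore_le hN)
      exact hΔ N x B _ _ hag (hB.trans (by omega))
    rcases h with h | h
    · exact key S S' h (hN.trans (Nat.le_succ _))
    · refine (le_of_eq (Finset.sum_congr rfl fun i _ => seqVariation_sub_comm _ _ _)).trans
        (key S' S h ?_)
      exact (NodeNeighbor.excess_le_add_one (Or.inl h) D N).trans (Nat.add_le_add_right hN 1)

end GraphStream

/-- The excess beyond which a stopped tree mechanism has stopped with high probability. -/
def excessBound (T : ℕ) (ε δ : ℝ) : ℕ := ⌈Real.log (200 * T / δ) * (6 / ε)⌉₊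

theorem exists_nodeDP_accurate {V : Type u} {κ : Type} [Fintype κ] [Nonempty κ] {Y : Type}
    [MeasurableSpace Y] [NormedAddCommGroup Y] {f : GraphOn V → κ → ℝ} (hf : f ⊥ = 0)
    {φ : (κ → ℝ) → Y} (hφ : Measurable φ)
    (hφ' : ∀ (y z : κ → ℝ) (r : ℝ), 0 ≤ r → (∀ i, |y i - z i| ≤ r) → ‖φ y - φ z‖ ≤ r)
    {ε δ Δ : ℝ} {D T : ℕ} (hε : 0 < ε) (hδ : 0 < δ) (hT : 2 ≤ T) (hΔ0 : 0 < Δ)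
    (hΔ : HasSensitivity V f (D + excessBound T ε δ + 1) (D + 2 * excessBound T ε δ + 2) Δ) :
    ∃ M : ContinualAlg V T Y, M.IsNodeDP ε δ ∧ M.IsAccurate (fun G => φ (f G)) D
      (2 * (Nat.log 2 T + 1) * Δ / ε *
        (2 * Real.log (200 * T * Fintype.card κ * 2 ^ (Nat.log 2 T + 1)))) := by
  set L := Nat.log 2 T + 1 with hL
  set b : ℝ := 2 * (Nat.log 2 T + 1) * Δ / ε with hb
  have hb0 : 0 < b := by positivity
  have hst := GraphStream.isStable_projected (T := T) hf hΔ
  refine ⟨stoppedTreeAlg hst hφ L ε b, ?_, fun S => ?_⟩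
  · refine stoppedTreeAlg_isNodeDP hst hφ (by omega)
      (Nat.lt_pow_succ_log_self one_lt_two T) hε hδ hb0 (le_of_eq ?_) (Nat.le_ceil _)
    rw [hb, Nat.cast_succ]
    field_simp
  · refine (stoppedTreeAlg_accurate hst hφ (L := L) (by omega) (ε := ε) hb0 S).trans
      (measureReal_mono fun ω hω t ht => ?_)
    have hdeg := S.degBefore_le_of_maxDegreeLE ht
    obtain ⟨y, hy1, hy2⟩ := hω t fun n hn => S.excess_eq_zero fun v =>
      (S.degBefore_mono v hn).trans (hdeg v)
    rw [hy1, ← S.projected_eq_flatten (by omega : D ≤ D + excessBound T ε δ + 1) ht]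
    refine hφ' _ _ _ ?_ hy2
    refine mul_nonneg hb0.le (mul_nonneg zero_le_two (Real.log_nonneg ?_))
    have h1 : (1 : ℝ) ≤ T := by exact_mod_cast (by omega : 1 ≤ T)
    have h2 : (1 : ℝ) ≤ Fintype.card κ := by exact_mod_cast Fintype.card_pos
    have h3 : (1 : ℝ) ≤ 2 ^ L := one_le_pow₀ one_le_two
    have h4 : (1 : ℝ) ≤ 200 * T := by linarith
    exact one_le_mul_of_one_le_of_one_le (one_le_mul_of_one_le_of_one_le h4 h2) h3

end

noncomputable section

section Bounds

open Real

lemma log_two_le_log {T : ℕ} (hT : 2 ≤ T) : log 2 ≤ log T :=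
  log_le_log two_pos (by exact_mod_cast hT)

lemma half_lt_log {T : ℕ} (hT : 2 ≤ T) : 1 / 2 < log T := by
  have := log_two_le_log hT
  have := log_two_gt_d9
  linarith

lemma log_sq_le {T : ℕ} (hT : 2 ≤ T) : log T ^ 2 ≤ 2 * log T ^ (5 / 2 : ℝ) := by
  have h := half_lt_log hT
  have h1 : log T ^ (5 / 2 : ℝ) = log T ^ 2 * √(log T) := by
    rw [sqrt_eq_rpow, ← rpow_natCast, ← rpow_add (by linarith)]
    norm_num
  have h2 : 1 / 2 ≤ √(log T) := le_sqrt_of_sq_le (by linarith)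
  rw [h1]
  nlinarith [sq_nonneg (log T)]

/-- The error of the stopped tree mechanism in closed form. -/
lemma treeError_le {T d : ℕ} (hT : 2 ≤ T) (hd : 1 ≤ d) {ε Δ : ℝ} (hε : 0 < ε) (hΔ : 0 ≤ Δ) :
    2 * (Nat.log 2 T + 1) * Δ / ε * (2 * log (200 * T * d * 2 ^ (Nat.log 2 T + 1))) ≤
      12 * (Δ / ε) * (log T * (11 * log T + log d)) := by
  have hlog2 := log_two_gt_d9
  have hlogT := log_two_le_log hT
  have hT0 : (0 : ℝ) < T := by exact_mod_cast (by omega : 0 < T)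
  have hd0 : (1 : ℝ) ≤ d := by exact_mod_cast hd
  have h1 : (Nat.log 2 T + 1 : ℝ) ≤ 3 * log T := by
    have h2 : (Nat.log 2 T : ℝ) ≤ log T / log 2 := by
      have := natLog_le_logb T 2
      simpa [logb] using this
    rw [le_div_iff₀ (by linarith)] at h2
    have h3 : (0 : ℝ) ≤ Nat.log 2 T := Nat.cast_nonneg _
    nlinarith
  have h2 : log (200 * T * d * 2 ^ (Nat.log 2 T + 1)) ≤ 11 * log T + log d := by
    have h3 : (2 : ℝ) ^ (Nat.log 2 T + 1) ≤ 2 * T := by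
      rw [pow_succ, mul_comm]
      have : 2 ^ Nat.log 2 T ≤ T := Nat.pow_log_le_self 2 (by omega)
      have : (2 : ℝ) ^ Nat.log 2 T ≤ T := by exact_mod_cast this
      linarith
    calc log (200 * T * d * 2 ^ (Nat.log 2 T + 1)) ≤ log (2 ^ 9 * T * T * d) := by
          refine log_le_log (by positivity) ?_
          calc 200 * (T : ℝ) * d * 2 ^ (Nat.log 2 T + 1) ≤ 200 * T * d * (2 * T) := by gcongr
            _ = 400 * (T * T * d) := by ring
            _ ≤ 2 ^ 9 * (T * T * d) :=
              mul_le_mul_of_nonneg_right (by norm_num) (by positivity)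
            _ = _ := by ring
      _ = 9 * log 2 + log T + log T + log d := by
          rw [log_mul (by positivity) (by positivity), log_mul (by positivity) (by positivity),
            log_mul (by positivity) (by positivity), log_pow]
          norm_num
      _ ≤ _ := by linarith
  have h3 : 0 ≤ 11 * log T + log d := by
    have := log_nonneg hd0
    linarith
  calc 2 * (Nat.log 2 T + 1) * Δ / ε * (2 * log (200 * T * d * 2 ^ (Nat.log 2 T + 1)))
      = 4 * (Δ / ε) * ((Nat.log 2 T + 1) * log (200 * T * d * 2 ^ (Nat.log 2 T + 1))) := by ring
    _ ≤ 4 * (Δ / ε) * ((Nat.log 2 T + 1) * (11 * log T + log d)) := by gcongr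
    _ ≤ 4 * (Δ / ε) * ((3 * log T) * (11 * log T + log d)) := by gcongr
    _ = _ := by ring

lemma half_le_log_div {T : ℕ} (hT : 2 ≤ T) {ε δ : ℝ} (hε : 0 < ε) (hε1 : ε ≤ 1) (hδ : 0 < δ)
    (hδ1 : δ ≤ 1) : log 2 ≤ log (T / δ) ∧ 1 / 2 ≤ 1 / ε * log (T / δ) := by
  have hT' : (2 : ℝ) ≤ T := by exact_mod_cast hT
  have h1 : log 2 ≤ log (T / δ) := by
    refine log_le_log two_pos ?_
    rw [le_div_iff₀ hδ]
    nlinarith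
  refine ⟨h1, ?_⟩
  have h2 := log_two_gt_d9
  have h3 : 1 ≤ 1 / ε := (one_le_div hε).mpr hε1
  nlinarith

lemma excessBound_le {T : ℕ} (hT : 2 ≤ T) {ε δ : ℝ} (hε : 0 < ε) (hε1 : ε ≤ 1) (hδ : 0 < δ)
    (hδ1 : δ ≤ 1) : (excessBound T ε δ : ℝ) ≤ 56 * (1 / ε * log (T / δ)) := by
  obtain ⟨h1, h2⟩ := half_le_log_div hT hε hε1 hδ hδ1
  have hT0 : (0 : ℝ) < T := by exact_mod_cast (by omega : 0 < T)
  have h3 : log (200 * T / δ) ≤ 9 * log (T / δ) := by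
    rw [mul_div_assoc, log_mul (by norm_num) (by positivity)]
    have h4 : log 200 ≤ 8 * log 2 := by
      calc log 200 ≤ log (2 ^ 8) := log_le_log (by norm_num) (by norm_num)
        _ = 8 * log 2 := by rw [log_pow]; norm_num
    linarith
  have hlog2 := log_two_gt_d9
  have h5 : (0 : ℝ) ≤ log (200 * T / δ) := by
    rw [mul_div_assoc, log_mul (by norm_num) (by positivity)]
    have : 0 ≤ log (200 : ℝ) := log_nonneg (by norm_num)
    linarith
  have h6 : (excessBound T ε δ : ℝ) < log (200 * T / δ) * (6 / ε) + 1 :=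
    Nat.ceil_lt_add_one (by positivity)
  have h7 : log (200 * T / δ) * (6 / ε) ≤ 9 * log (T / δ) * (6 / ε) := by gcongr
  have h8 : 9 * log (T / δ) * (6 / ε) = 54 * (1 / ε * log (T / δ)) := by ring
  linarith

end Bounds

section Statistics

variable {V : Type u}

lemma ContinualAlg.IsAccurate.mono {T : ℕ} {Y : Type} [MeasurableSpace Y] [NormedAddCommGroup Y]
    {M : ContinualAlg V T Y} {f : GraphOn V → Y} {D : ℕ} {α β : ℝ} (h : M.IsAccurate f D α)
    (hαβ : α ≤ β) : M.IsAccurate f D β := fun S =>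
  (h S).trans (measureReal_mono fun _ hω t ht => (hω t ht).trans hαβ)

lemma GraphOn.numEdges_bot : GraphOn.numEdges (⊥ : GraphOn V) = 0 := by simp [GraphOn.numEdges]

lemma GraphOn.numTriangles_bot : GraphOn.numTriangles (⊥ : GraphOn V) = 0 := by
  unfold GraphOn.numTriangles
  rw [Nat.cast_eq_zero]
  convert Set.ncard_empty (Finset V)
  refine Set.eq_empty_iff_forall_notMem.mpr fun s hs => ?_
  obtain ⟨u, hu, v, hv, huv⟩ := Finset.one_lt_card.mp (by rw [hs.1]; norm_num : 1 < s.card)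
  exact hs.2 u hu v hv huv

lemma GraphOn.numStars_bot (k : ℕ) : GraphOn.numStars k (⊥ : GraphOn V) = 0 := by
  simp [GraphOn.numStars]

lemma GraphOn.numComponents_bot : GraphOn.numComponents (⊥ : GraphOn V) = 0 := by
  simp [GraphOn.numComponents_eq, numComponentsMeeting]

lemma GraphOn.degreeHist_bot (D : ℕ) : GraphOn.degreeHist D (⊥ : GraphOn V) = 0 := by
  funext i
  simp [GraphOn.degreeHist]

theorem exists_nodeDP_accurate_real {f : GraphOn V → ℝ} (hf : f ⊥ = 0) {ε δ Δ : ℝ} {D T : ℕ}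
    (hε : 0 < ε) (hδ : 0 < δ) (hT : 2 ≤ T) (hΔ0 : 0 < Δ)
    (hΔ : ∀ (N : ℕ) (x : V) (B : Finset (Sym2 V)) (P P' : ℕ → GraphOn V),
      AgreeOff N (D + excessBound T ε δ + 1) x B P P' →
        B.card ≤ D + 2 * excessBound T ε δ + 2 →
          seqVariation N (fun n => f (P n) - f (P' n)) ≤ Δ) :
    ∃ M : ContinualAlg V T ℝ, M.IsNodeDP ε δ ∧
      M.IsAccurate f D (264 * Δ * (Real.log T ^ (5 / 2 : ℝ) / ε)) := by
  obtain ⟨M, hM, hacc⟩ := exists_nodeDP_accurate (κ := Unit) (f := fun G _ => f G)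
    (φ := fun y => y ()) (funext fun _ => hf) (measurable_pi_apply ())
    (fun y z r _ h => h ()) hε hδ hT hΔ0
    (fun N x B P P' h hB => by simpa using hΔ N x B P P' h hB)
  refine ⟨M, hM, hacc.mono ((treeError_le hT (by simp) hε hΔ0.le).trans ?_)⟩
  have h := log_sq_le hT
  simp only [Fintype.card_unit, Nat.cast_one, Real.log_one, add_zero]
  calc 12 * (Δ / ε) * (Real.log T * (11 * Real.log T))
      = 132 * (Δ / ε) * Real.log T ^ 2 := by ring
    _ ≤ 132 * (Δ / ε) * (2 * Real.log T ^ (5 / 2 : ℝ)) := by gcongr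
    _ = _ := by ring

lemma pi_norm_sub_le_of_forall {D : ℕ} (y z : Fin (D + 1) → ℝ) (r : ℝ) (hr : 0 ≤ r)
    (h : ∀ i, |y i - z i| ≤ r) : ‖y - z‖ ≤ r :=
  (pi_norm_le_iff_of_nonneg hr).mpr h

theorem exists_nodeDP_accurate_degreeHist {ε δ Δ : ℝ} {D T : ℕ}
    (hε : 0 < ε) (hε1 : ε ≤ 1) (hδ : 0 < δ) (hδ1 : δ ≤ 1) (hT : 2 ≤ T)
    (hΔ : Δ = (D + 1) * (4 * (2 * (D + 2 * excessBound T ε δ + 2) + 1))) :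
    ∃ M : ContinualAlg V T (Fin (D + 1) → ℝ), M.IsNodeDP ε δ ∧
      M.IsAccurate (GraphOn.degreeHist D) D (576 * Δ * (Real.log T ^ (5 / 2 : ℝ) / ε *
        Real.log (2 + D + 1 / ε * Real.log (T / δ)))) := by
  have hΔ0 : 0 < Δ := by
    rw [hΔ]
    positivity
  obtain ⟨M, hM, hacc⟩ := exists_nodeDP_accurate (f := GraphOn.degreeHist (V := V) D)
    (φ := fun y => y) (GraphOn.degreeHist_bot D) measurable_id
    pi_norm_sub_le_of_forall hε hδ hT hΔ0
    (fun N x B P P' h hB => by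
      refine (Finset.sum_le_card_nsmul _ _ _ fun i _ => h.seqVariation_degreeHist_le i).trans ?_
      rw [Finset.card_univ, Fintype.card_fin, nsmul_eq_mul, hΔ]
      have hB' : (B.card : ℝ) ≤ D + 2 * excessBound T ε δ + 2 := by exact_mod_cast hB
      push_cast
      gcongr)
  refine ⟨M, hM, hacc.mono ((treeError_le hT (by simp) hε hΔ0.le).trans ?_)⟩
  have h := log_sq_le hT
  obtain ⟨-, hq⟩ := half_le_log_div hT hε hε1 hδ hδ1
  set q := 1 / ε * Real.log (T / δ) with hqdef
  have hlogT := half_lt_log hT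
  have hD0 : (0 : ℝ) ≤ D := Nat.cast_nonneg _
  have h1 : Real.log (D + 1) ≤ Real.log (2 + D + q) :=
    Real.log_le_log (by positivity) (by linarith)
  have h2 : 1 / 2 ≤ Real.log (2 + D + q) := by
    have h3 : Real.log 2 ≤ Real.log (2 + D + q) := Real.log_le_log two_pos (by linarith)
    have := Real.log_two_gt_d9
    linarith
  set Q := Real.log (2 + D + q) with hQ
  have h3 : 11 * Real.log T + Real.log (D + 1) ≤ 24 * (Real.log T * Q) := by nlinarith
  rw [Fintype.card_fin]
  push_cast
  calc 12 * (Δ / ε) * (Real.log T * (11 * Real.log T + Real.log (D + 1)))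
      ≤ 12 * (Δ / ε) * (Real.log T * (24 * (Real.log T * Q))) := by gcongr
    _ = 288 * (Δ / ε) * Q * Real.log T ^ 2 := by ring
    _ ≤ 288 * (Δ / ε) * Q * (2 * Real.log T ^ (5 / 2 : ℝ)) := by gcongr
    _ = _ := by ring

end Statistics

end

theorem mainTheorem4 :
    -- edges
    (∃ C : ℝ, 0 < C ∧ ∀ (V : Type u) (ε δ : ℝ) (D T : ℕ),
      0 < ε → ε ≤ 1 → 0 < δ → δ ≤ 1 → 2 ≤ T →
      ∃ M : ContinualAlg V T ℝ, M.IsNodeDP ε δ ∧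
        M.IsAccurate GraphOn.numEdges D
          (C * (((D : ℝ) + 1 / ε * Real.log (T / δ)) *
            (Real.log T ^ (5 / 2 : ℝ) / ε)))) ∧
    -- triangles
    (∃ C : ℝ, 0 < C ∧ ∀ (V : Type u) (ε δ : ℝ) (D T : ℕ),
      0 < ε → ε ≤ 1 → 0 < δ → δ ≤ 1 → 2 ≤ T →
      ∃ M : ContinualAlg V T ℝ, M.IsNodeDP ε δ ∧
        M.IsAccurate GraphOn.numTriangles D
          (C * (((D : ℝ) ^ 2 + 1 / ε ^ 2 * Real.log (T / δ) ^ 2) *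
            (Real.log T ^ (5 / 2 : ℝ) / ε)))) ∧
    -- connected components
    (∃ C : ℝ, 0 < C ∧ ∀ (V : Type u) (ε δ : ℝ) (D T : ℕ),
      0 < ε → ε ≤ 1 → 0 < δ → δ ≤ 1 → 2 ≤ T →
      ∃ M : ContinualAlg V T ℝ, M.IsNodeDP ε δ ∧
        M.IsAccurate GraphOn.numComponents D
          (C * (((D : ℝ) + 1 / ε * Real.log (T / δ)) *
            (Real.log T ^ (5 / 2 : ℝ) / ε)))) ∧
    -- k-stars
    (∀ k : ℕ, 1 ≤ k → ∃ C : ℝ, 0 < C ∧ ∀ (V : Type u) (ε δ : ℝ) (D T : ℕ),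
      0 < ε → ε ≤ 1 → 0 < δ → δ ≤ 1 → 2 ≤ T →
      ∃ M : ContinualAlg V T ℝ, M.IsNodeDP ε δ ∧
        M.IsAccurate (GraphOn.numStars k) D
          (C * (((D : ℝ) ^ k + 1 / ε ^ k * Real.log (T / δ) ^ k) *
            (Real.log T ^ (5 / 2 : ℝ) / ε)))) ∧
    -- degree histograms
    (∃ C : ℝ, 0 < C ∧ ∀ (V : Type u) (ε δ : ℝ) (D T : ℕ),
      0 < ε → ε ≤ 1 → 0 < δ → δ ≤ 1 → 2 ≤ T →
      ∃ M : ContinualAlg V T (Fin (D + 1) → ℝ), M.IsNodeDP ε δ ∧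
        M.IsAccurate (GraphOn.degreeHist D) D
          (C * (((D : ℝ) ^ 2 + 1 / ε ^ 2 * Real.log (T / δ) ^ 2) *
            (Real.log T ^ (5 / 2 : ℝ) / ε) *
            Real.log (2 + D + 1 / ε * Real.log (T / δ))))) := by
  have hX : ∀ {T : ℕ} {ε : ℝ}, 0 < ε → 0 ≤ Real.log T ^ (5 / 2 : ℝ) / ε := fun {T ε} hε =>
    div_nonneg (Real.rpow_nonneg (Real.log_natCast_nonneg T) _) hε.le
  have hq : ∀ (k : ℕ) (ε x : ℝ), 1 / ε ^ k * x ^ k = (1 / ε * x) ^ k := fun k ε x => by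
    rw [mul_pow, one_div_pow]
  refine ⟨⟨264 * 480, by norm_num, ?_⟩, ⟨264 * 60000, by norm_num, ?_⟩,
    ⟨264 * 480, by norm_num, ?_⟩,
    fun k hk => ⟨264 * (8 * (120 ^ k * 2 ^ (k - 1))), by positivity, ?_⟩,
    ⟨576 * 4000, by norm_num, ?_⟩⟩
  all_goals
    intro V ε δ D T hε hε1 hδ hδ1 hT
    obtain ⟨-, h1⟩ := half_le_log_div hT hε hε1 hδ hδ1
    have h2 := excessBound_le hT hε hε1 hδ hδ1
    have hD : (0 : ℝ) ≤ D := Nat.cast_nonneg D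
    have hE : (0 : ℝ) ≤ excessBound T ε δ := Nat.cast_nonneg _
    have hXT := hX (T := T) hε
    try rw [hq]
    set q := 1 / ε * Real.log (T / δ) with hqdef
    set E := excessBound T ε δ with hEdef
  · obtain ⟨M, hM, hacc⟩ := exists_nodeDP_accurate_real (V := V) GraphOn.numEdges_bot
      (Δ := 4 * (D + 2 * E + 2)) (D := D) hε hδ hT (by positivity) fun N x B P P' h hB => by
        have hB : (B.card : ℝ) ≤ D + 2 * E + 2 := by exact_mod_cast hB
        linarith [h.seqVariation_numEdges_le]
    refine ⟨M, hM, hacc.mono ?_⟩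
    refine (mul_le_mul_of_nonneg_right ?_ hXT).trans_eq (mul_assoc _ _ _)
    linarith
  · obtain ⟨M, hM, hacc⟩ := exists_nodeDP_accurate_real (V := V) GraphOn.numTriangles_bot
      (Δ := 4 * ((D + E + 1) * (D + 2 * E + 2))) (D := D) hε hδ hT (by positivity)
      fun N x B P P' h hB => by
        have hB : (B.card : ℝ) ≤ D + 2 * E + 2 := by exact_mod_cast hB
        refine h.seqVariation_numTriangles_le.trans ?_
        push_cast
        gcongr
    refine ⟨M, hM, hacc.mono ?_⟩
    refine (mul_le_mul_of_nonneg_right ?_ hXT).trans_eq (mul_assoc _ _ _)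
    have h3 : (D + E + 1 : ℝ) * (D + 2 * E + 2) ≤ (60 * (D + q)) * (120 * (D + q)) := by
      gcongr <;> linarith
    nlinarith [sq_nonneg ((D : ℝ) - q)]
  · obtain ⟨M, hM, hacc⟩ := exists_nodeDP_accurate_real (V := V) GraphOn.numComponents_bot
      (Δ := 4 * (D + 2 * E + 2) + 1) (D := D) hε hδ hT (by positivity) fun N x B P P' h hB => by
        have hB : (B.card : ℝ) ≤ D + 2 * E + 2 := by exact_mod_cast hB
        linarith [h.seqVariation_numComponents_le]
    refine ⟨M, hM, hacc.mono ?_⟩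
    refine (mul_le_mul_of_nonneg_right ?_ hXT).trans_eq (mul_assoc _ _ _)
    linarith
  · obtain ⟨M, hM, hacc⟩ := exists_nodeDP_accurate_real (V := V) (GraphOn.numStars_bot k)
      (Δ := 4 * (2 * (D + E + 1) ^ (k - 1) * (D + 2 * E + 2))) (D := D) hε hδ hT (by positivity)
      fun N x B P P' h hB => by
        have hB : (B.card : ℝ) ≤ D + 2 * E + 2 := by exact_mod_cast hB
        refine (h.seqVariation_numStars_le hk).trans ?_
        push_cast
        gcongr
    refine ⟨M, hM, hacc.mono ?_⟩
    refine (mul_le_mul_of_nonneg_right ?_ hXT).trans_eq (mul_assoc _ _ _)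
    have h3 : (D + E + 1 : ℝ) ^ (k - 1) * (D + 2 * E + 2) ≤ 120 ^ k * (D + q) ^ k := by
      calc (D + E + 1 : ℝ) ^ (k - 1) * (D + 2 * E + 2)
          ≤ (120 * (D + q)) ^ (k - 1) * (120 * (D + q)) := by gcongr <;> linarith
        _ = 120 ^ k * (D + q) ^ k := by rw [pow_sub_one_mul (by omega), mul_pow]
    have h4 := add_pow_le hD (by linarith : 0 ≤ q) k
    have h5 : (120 : ℝ) ^ k * (D + q) ^ k ≤ 120 ^ k * (2 ^ (k - 1) * (D ^ k + q ^ k)) := by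
      gcongr
    linarith
  · obtain ⟨M, hM, hacc⟩ := exists_nodeDP_accurate_degreeHist (V := V) (D := D) hε hε1 hδ hδ1 hT rfl
    refine ⟨M, hM, hacc.mono ?_⟩
    rw [mul_assoc (_ + _) _ _, ← mul_assoc (576 * 4000 : ℝ)]
    have hlog : 0 ≤ Real.log (2 + D + q) := Real.log_nonneg (by linarith)
    refine mul_le_mul_of_nonneg_right ?_ (mul_nonneg hXT hlog)
    have h3 : ((D : ℝ) + 1) * (4 * (2 * (D + 2 * E + 2) + 1)) ≤
        (2 * (D + q)) * (4 * (240 * (D + q))) := by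
      gcongr <;> linarith
    nlinarith [sq_nonneg ((D : ℝ) - q)]
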